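/- Let $n\ge 1$ be an integer and let $\alpha\in\mathbb R$ with $\alpha\notin\pi\mathbb Z$. Let $\mathbf T^n_\alpha$ be the cube $[-|\sin\alpha|/2,|\sin\alpha|/2]^n$ with opposite sides identified and with Lebesgue measure, so that functions on $\mathbf T^n_\alpha$ are functions on $\mathbb R^n$ that are $|\sin\alpha|$-periodic in every coordinate. Put $e_\alpha(x)=e^{\pi i|x|^2\cot\alpha}$. For $1\le p\le\infty$ let $e_{-\alpha}L^p(\mathbf T^n_\alpha)$ be the space of functions $f$ on the cube with $f=e_{-\alpha}g$ almost everywhere for some $g\in L^p(\mathbf T^n_\alpha)$, with norm $\|f\|_{L^p}$ taken over the cube. For $f\in e_{-\alpha}L^1(\mathbf T^n_\alpha)$ and an integer $N\ge 0$ define the fractional Fejér means $$(f\overset{\alpha}{\ast}F^n_N)(x)=|\csc\alpha|^n e_{-\alpha}(x)\int_{[-|\sin\alpha|/2,|\sin\alpha|/2]^n}e_\alpha(y)f(y)\,F^n_N\big((x-y)\csc\alpha\big)\,dy,$$ where $F^n_N(x)=\prod_{j=1}^nF^1_N(x_j)$, $F^1_N=\frac1{N+1}\sum_{k=0}^N D_k$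 and $D_k(t)=\sum_{|m|\le k}e^{2\pi imt}$. Let $$\mathcal H_\alpha f(x)=\sup_{N\ge 0}\big|(f\overset{\alpha}{\ast}F^n_N)(x)\big|\in[0,\infty].$$ (a) $\mathcal H_\alpha$ is bounded from $e_{-\alpha}L^1(\mathbf T^n_\alpha)$ to weak $L^1$: there is a constant $C=C(n,\alpha)<\infty$ such that for all $f\in e_{-\alpha}L^1(\mathbf T^n_\alpha)$ one has $\mathcal H_\alpha f\in L^{1,\infty}(\mathbf T^n_\alpha)$ and $$\|\mathcal H_\alpha f\|_{L^{1,\infty}}:=\sup_{t>0}\,t\,\big|\{x\in \mathbf T^n_\alpha:\mathcal H_\alpha f(x)>t\}\big|\le C\|f\|_{L^1}.$$ For every $1<p\le\infty$, $\mathcal H_\alpha$ is bounded from $e_{-\alpha}L^p(\mathbf T^n_\alpha)$ to $L^p(\mathbf T^n_\alpha)$: there is a constant $C=C(n,\alpha,p)<\infty$ such that for all $f\in e_{-\alpha}L^p(\mathbf T^n_\alpha)$ one has $\mathcal H_\alpha f\in L^p(\mathbf T^n_\alpha)$ and $\|\mathcal H_\alpha f\|_{L^p}\le C\|f\|_{L^p}$.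 (b) For every $f\in e_{-\alpha}L^1(\mathbf T^n_\alpha)$, $(f\overset{\alpha}{\ast}F^n_N)(x)\to f(x)$ as $N\to\infty$ for almost every $x\in\mathbf T^n_\alpha$. -/

import Mathlib

open MeasureTheory Filter Topology
open scoped ENNReal NNReal

noncomputable section

/-- The chirp `e_α(x) = exp(π i |x|² cot α)`, with `|x|` the Euclidean length of `x ∈ ℝⁿ`. -/
def chirp {n : ℕ} (α : ℝ) (x : Fin n → ℝ) : ℂ :=
  Complex.exp ((Real.pi * (∑ i, x i ^ 2) * Real.cot α : ℝ) * Complex.I)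

/-- The fundamental cube `[-|sin α|/2, |sin α|/2]ⁿ` of the fractional torus of order `α`. -/
def fracCube (n : ℕ) (α : ℝ) : Set (Fin n → ℝ) :=
  Set.Icc (fun _ => -(|Real.sin α| / 2)) (fun _ => |Real.sin α| / 2)

/-- The measure of the fractional torus: Lebesgue measure on the fundamental cube. -/
def torusMeasure (n : ℕ) (α : ℝ) : Measure (Fin n → ℝ) :=
  volume.restrict (fracCube n α)

/-- Functions on the fractional torus: `|sin α|`-periodic in every coordinate. -/
def IsTorusFun {n : ℕ} {E : Type*} (α : ℝ) (g : (Fin n → ℝ) → E) : Prop :=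
  ∀ (m : Fin n → ℤ) (x : Fin n → ℝ), g (fun i => x i + |Real.sin α| * m i) = g x

/-- Membership in the Lebesgue space `L^p` of the fractional torus. -/
def MemTorusLp {n : ℕ} {E : Type*} [TopologicalSpace E] [ENorm E] (α : ℝ) (p : ℝ≥0∞)
    (g : (Fin n → ℝ) → E) : Prop :=
  IsTorusFun α g ∧ MemLp g p (torusMeasure n α)

/-- The quasi-norm of weak `L¹`: `sup_{t > 0} t · μ {x : |g x| > t}`
(the term `t = 0` contributes `0`). -/
def weakL1Norm {X E : Type*} [MeasurableSpace X] [ENorm E] (g : X → E) (μ : Measure X) : ℝ≥0∞ :=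
  ⨆ t : ℝ≥0, (t : ℝ≥0∞) * μ {x | (t : ℝ≥0∞) < ‖g x‖ₑ}

/-- Membership in the weak space `L^{1,∞}` of the fractional torus. -/
def MemTorusWeakL1 {n : ℕ} {E : Type*} [TopologicalSpace E] [ENorm E] (α : ℝ)
    (g : (Fin n → ℝ) → E) : Prop :=
  IsTorusFun α g ∧ AEStronglyMeasurable g (torusMeasure n α) ∧
    weakL1Norm g (torusMeasure n α) < ∞

/-- Membership in `e_{-α} L^p`: on the fundamental cube `f = e_{-α} g` almost everywhere, with
`g ∈ L^p` of the fractional torus, and the `L^p` norm of `f` is finite.  Such an `f` matters only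
through its values on the cube. -/
def MemFracLp {n : ℕ} (α : ℝ) (p : ℝ≥0∞) (f : (Fin n → ℝ) → ℂ) : Prop :=
  (∃ g : (Fin n → ℝ) → ℂ, MemTorusLp α p g ∧
    f =ᵐ[torusMeasure n α] fun x => chirp (-α) x * g x) ∧
  eLpNorm f p (torusMeasure n α) < ∞

/-- The fractional convolution
`(f ∗_α g)(x) = |csc α|ⁿ e_{-α}(x) ∫ e_α(y) f(y) g((x - y) csc α) dy`,
the integral being over the fundamental cube. -/
def fracConv {n : ℕ} (α : ℝ) (f g : (Fin n → ℝ) → ℂ) (x : Fin n → ℝ) : ℂ :=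
  ((|(Real.sin α)⁻¹| ^ n : ℝ) : ℂ) * chirp (-α) x *
    ∫ y in fracCube n α, chirp α y * f y * g (fun i => (x i - y i) * (Real.sin α)⁻¹)

/-- The one-dimensional Dirichlet kernel `∑_{|m| ≤ N} exp(2π i m x)`. -/
def dirichletKer (N : ℕ) (x : ℝ) : ℂ :=
  ∑ m ∈ Finset.Icc (-(N : ℤ)) (N : ℤ), Complex.exp (2 * Real.pi * Complex.I * m * x)

/-- The one-dimensional Fejér kernel, the arithmetic mean of the Dirichlet kernels. -/
def fejerKer1 (N : ℕ) (x : ℝ) : ℂ :=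
  1 / ((N : ℂ) + 1) * ∑ k ∈ Finset.range (N + 1), dirichletKer k x

/-- The `n`-dimensional Fejér kernel, the product of one-dimensional ones. -/
def fejerKer (n N : ℕ) (x : Fin n → ℝ) : ℂ :=
  ∏ j, fejerKer1 N (x j)

/-- The fractional Fejér means `f ∗_α F_N^n`. -/
def fejerMean {n : ℕ} (α : ℝ) (N : ℕ) (f : (Fin n → ℝ) → ℂ) : (Fin n → ℝ) → ℂ :=
  fracConv α f (fejerKer n N)

/-- The maximal fractional Fejér operator `sup_{N ≥ 0} |f ∗_α F_N^n|`, with values in `[0, ∞]`. -/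
def maximalFejer {n : ℕ} (α : ℝ) (f : (Fin n → ℝ) → ℂ) (x : Fin n → ℝ) : ℝ≥0∞ :=
  ⨆ N : ℕ, ‖fejerMean α N f x‖ₑ

end

/-!
The chirp `e_α` has modulus one, so `|f ∗_α F_N|` is bounded by the convolution of `|f|`, extended
periodically with period `s = |sin α|`, with the rescaled product Fejér kernel. The bounds are proved
in `ℝⁿ`: on the cube only the translates of `f` by `s • l`, `l ∈ {-1, 0, 1} ^ n`, matter
(`periodized`).

The product kernel has no integrable radially decreasing majorant when `n ≥ 2`, so the usual
Hardy–Littlewood maximal function is not enough, and the strong maximal function is not of weak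
type `(1,1)`. But the same `N` is used in all coordinates. In one variable
`F_N ≤ (N + 1) 4⁻ᵏ` for a `k` with `(N + 1) |x| ≤ 2ᵏ` (`exists_norm_fejerKer1_le`), so
the product kernel is at most a sum, over shapes `k ∈ ℕⁿ` and with weights of size `∏ 2⁻ᵏʲ`, of
normalized indicators of boxes with half-sides `2ᵏʲ s / (N + 1)` (`enorm_fejerKer_le`). For one shape
these boxes are the balls of a norm, and the Vitali covering lemma gives a weak `(1,1)` bound with
constant `3ⁿ`, whatever the shape (`mul_volume_exists_dyadicBox_le`). The weights decay geometrically,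
which is enough to sum the weak type bounds (`exists_mul_volume_boxMaximal_le`). The `L^∞` bound is
immediate, and Marcinkiewicz interpolation (`lintegral_rpow_le_of_weak_type`) gives `1 < p < ∞`.

For the convergence almost everywhere, the Fejér means of `e_{-α} P`, with `P` a trigonometric
polynomial of period `sin α`, converge everywhere, by Cesàro's theorem
(`tendsto_fejerMean_of_mem_span`); these functions are dense in `L¹`
(`exists_mem_span_eLpNorm_sub_le`, from Stone–Weierstrass on the torus), and the weak type bound
carries the convergence over to all `f`.
-/

/-! ### The Fejér kernel -/

theorem sum_pow_mul_inv_pow {z : ℂ} (hz : z ≠ 0) (k : ℕ) :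
    (∑ j ∈ Finset.range k, z ^ j) * z⁻¹ ^ k = ∑ j ∈ Finset.range k, z⁻¹ ^ (j + 1) := by
  induction k with
  | zero => simp
  | succ k ih =>
    rw [Finset.sum_range_succ, Finset.sum_range_succ', add_mul]
    have h1 : (∑ j ∈ Finset.range k, z ^ j) * z⁻¹ ^ (k + 1)
        = ∑ j ∈ Finset.range k, z⁻¹ ^ (j + 1 + 1) := by
      rw [pow_succ, ← mul_assoc, ih, Finset.sum_mul]
      exact Finset.sum_congr rfl fun j _ => (pow_succ _ _).symm
    rw [h1]
    congr 1
    rw [pow_succ, ← mul_assoc, ← mul_pow, mul_inv_cancel₀ hz]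
    simp

theorem sum_zpow_Icc_eq (z : ℂ) (k : ℕ) :
    ∑ m ∈ Finset.Icc (-(k : ℤ)) k, z ^ m
      = 1 + ∑ j ∈ Finset.range k, z ^ (j + 1) + ∑ j ∈ Finset.range k, z⁻¹ ^ (j + 1) := by
  induction k with
  | zero => simp
  | succ k ih =>
    have h : Finset.Icc (-((k + 1 : ℕ) : ℤ)) ((k + 1 : ℕ) : ℤ)
        = insert (((k + 1 : ℕ) : ℤ)) (insert (-((k + 1 : ℕ) : ℤ)) (Finset.Icc (-(k : ℤ)) k)) := by
      ext m
      simp only [Finset.mem_insert, Finset.mem_Icc]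
      omega
    rw [h, Finset.sum_insert (by simp only [Finset.mem_insert, Finset.mem_Icc]; omega),
      Finset.sum_insert (by simp only [Finset.mem_Icc]; omega), ih, Finset.sum_range_succ,
      Finset.sum_range_succ, zpow_neg, zpow_natCast, inv_pow]
    ring

/-- The algebraic identity behind the closed form of the Fejér kernel: on the unit circle the left
side is `|∑ z ^ j|²`. -/
theorem sum_pow_mul_sum_inv_pow {z : ℂ} (hz : z ≠ 0) (N : ℕ) :
    (∑ j ∈ Finset.range N, z ^ j) * ∑ j ∈ Finset.range N, z⁻¹ ^ j
      = ∑ k ∈ Finset.range N, ∑ m ∈ Finset.Icc (-(k : ℤ)) k, z ^ m := by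
  induction N with
  | zero => simp
  | succ N ih =>
    rw [Finset.sum_range_succ, Finset.sum_range_succ, Finset.sum_range_succ _ N, ← ih,
      sum_zpow_Icc_eq, ← sum_pow_mul_inv_pow hz]
    have h := sum_pow_mul_inv_pow (inv_ne_zero hz) N
    rw [inv_inv] at h
    rw [← h]
    have h2 : z ^ N * z⁻¹ ^ N = 1 := by rw [← mul_pow, mul_inv_cancel₀ hz, one_pow]
    linear_combination h2

/-- Closed form of the Fejér kernel: the product on the right is `|∑ z ^ j|²`, `z = e^{2πix}`. -/
theorem fejerKer1_eq (N : ℕ) (x : ℝ) :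
    fejerKer1 N x = 1 / ((N : ℂ) + 1) *
      ((∑ j ∈ Finset.range (N + 1), Complex.exp (2 * Real.pi * x * Complex.I) ^ j) *
        ∑ j ∈ Finset.range (N + 1), (Complex.exp (2 * Real.pi * x * Complex.I))⁻¹ ^ j) := by
  rw [sum_pow_mul_sum_inv_pow (Complex.exp_ne_zero _), fejerKer1]
  congr 1
  refine Finset.sum_congr rfl fun k _ => Finset.sum_congr rfl fun m _ => ?_
  rw [← Complex.exp_int_mul]
  congr 1
  ring

theorem norm_sum_pow_le {z : ℂ} (hz : ‖z‖ = 1) (N : ℕ) :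
    ‖∑ j ∈ Finset.range N, z ^ j‖ ≤ N := by
  refine (norm_sum_le _ _).trans ?_
  simp [hz]

theorem norm_sum_pow_mul_le {z : ℂ} (hz : ‖z‖ = 1) (N : ℕ) :
    ‖∑ j ∈ Finset.range N, z ^ j‖ * ‖z - 1‖ ≤ 2 := by
  rw [← norm_mul, geom_sum_mul]
  refine (norm_sub_le _ _).trans ?_
  simp [hz]
  norm_num

theorem norm_exp_two_pi (x : ℝ) : ‖Complex.exp (2 * Real.pi * x * Complex.I)‖ = 1 := by
  have := Complex.norm_exp_ofReal_mul_I (2 * Real.pi * x)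
  push_cast at this
  exact this

theorem norm_fejerKer1_eq (N : ℕ) (x : ℝ) :
    ‖fejerKer1 N x‖ * (N + 1) =
      ‖∑ j ∈ Finset.range (N + 1), Complex.exp (2 * Real.pi * x * Complex.I) ^ j‖ *
        ‖∑ j ∈ Finset.range (N + 1), (Complex.exp (2 * Real.pi * x * Complex.I))⁻¹ ^ j‖ := by
  have h : ‖(N : ℂ) + 1‖ = (N : ℝ) + 1 := by
    rw [← Nat.cast_add_one, Complex.norm_natCast]
    push_cast
    rfl
  have h0 : (0 : ℝ) < N + 1 := by positivity
  rw [fejerKer1_eq, norm_mul, norm_div, norm_one, h, norm_mul]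
  field_simp

theorem norm_fejerKer1_le (N : ℕ) (x : ℝ) : ‖fejerKer1 N x‖ ≤ N + 1 := by
  have h0 : (0 : ℝ) < N + 1 := by positivity
  refine le_of_mul_le_mul_right ?_ h0
  rw [norm_fejerKer1_eq]
  have h1 := norm_sum_pow_le (norm_exp_two_pi x) (N + 1)
  have h2 := norm_sum_pow_le (z := (Complex.exp (2 * Real.pi * x * Complex.I))⁻¹)
    (by rw [norm_inv, norm_exp_two_pi, inv_one]) (N + 1)
  push_cast at h1 h2
  gcongr

theorem four_mul_abs_le_norm_exp_sub_one {x : ℝ} (hx : |x| ≤ 1 / 2) :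
    4 * |x| ≤ ‖Complex.exp (2 * Real.pi * x * Complex.I) - 1‖ := by
  have h := Complex.norm_exp_I_mul_ofReal_sub_one (2 * Real.pi * x)
  have h' : Complex.exp (2 * Real.pi * x * Complex.I)
      = Complex.exp (Complex.I * ((2 * Real.pi * x : ℝ) : ℂ)) := by
    congr 1; push_cast; ring
  rw [h', h, Real.norm_eq_abs, abs_mul, abs_two,
    show 2 * Real.pi * x / 2 = Real.pi * x by ring]
  have hpi := Real.pi_pos
  have h1 : 2 / Real.pi * (Real.pi * |x|) ≤ Real.sin (Real.pi * |x|) := by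
    refine Real.mul_le_sin (by positivity) ?_
    nlinarith
  have h2 : 2 / Real.pi * (Real.pi * |x|) = 2 * |x| := by field_simp
  have h3 : Real.sin (Real.pi * |x|) ≤ |Real.sin (Real.pi * x)| := by
    rcases abs_cases x with ⟨h, _⟩ | ⟨h, _⟩ <;> rw [h]
    · exact le_abs_self _
    · rw [mul_neg, Real.sin_neg]; exact neg_le_abs _
  linarith

theorem norm_fejerKer1_mul_sq_le (N : ℕ) {x : ℝ} (hx : |x| ≤ 1 / 2) :
    ‖fejerKer1 N x‖ * (4 * ((N + 1) * x ^ 2)) ≤ 1 := by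
  set z := Complex.exp (2 * Real.pi * x * Complex.I) with hz
  have hz1 : ‖z‖ = 1 := norm_exp_two_pi x
  have hz0 : z ≠ 0 := Complex.exp_ne_zero _
  have h1 := norm_sum_pow_mul_le hz1 (N + 1)
  have h2 := norm_sum_pow_mul_le (z := z⁻¹) (by rw [norm_inv, hz1, inv_one]) (N + 1)
  have h3 : ‖z⁻¹ - 1‖ = ‖z - 1‖ := by
    have : z⁻¹ - 1 = z⁻¹ * (1 - z) := by rw [mul_sub, inv_mul_cancel₀ hz0, mul_one]
    rw [this, norm_mul, norm_inv, hz1, inv_one, one_mul, norm_sub_rev]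
  rw [h3] at h2
  have h4 : 4 * |x| ≤ ‖z - 1‖ := four_mul_abs_le_norm_exp_sub_one hx
  have h5 := norm_fejerKer1_eq N x
  rw [← hz] at h5
  have h6 : (4 * |x|) * (4 * |x|) ≤ ‖z - 1‖ * ‖z - 1‖ := by gcongr
  have h7 : (‖∑ j ∈ Finset.range (N + 1), z ^ j‖ * ‖z - 1‖) *
      (‖∑ j ∈ Finset.range (N + 1), z⁻¹ ^ j‖ * ‖z - 1‖) ≤ 2 * 2 := by gcongr
  have h8 : ‖fejerKer1 N x‖ * (N + 1) * ((4 * |x|) * (4 * |x|)) ≤ 2 * 2 := by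
    calc ‖fejerKer1 N x‖ * (N + 1) * ((4 * |x|) * (4 * |x|))
        ≤ ‖fejerKer1 N x‖ * (N + 1) * (‖z - 1‖ * ‖z - 1‖) := by gcongr
      _ = _ := by rw [h5]; ring
      _ ≤ 2 * 2 := h7
  have h9 : |x| * |x| = x ^ 2 := by rw [abs_mul_abs_self]; ring
  have : ‖fejerKer1 N x‖ * (4 * ((N + 1) * x ^ 2)) * 4
      = ‖fejerKer1 N x‖ * (N + 1) * ((4 * |x|) * (4 * |x|)) := by
    rw [← h9]; ring
  linarith

/-- Dyadic form of the bound `F_N(x) ≤ min (N + 1) (1 / (4 (N + 1) x²))`. -/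
theorem exists_norm_fejerKer1_le (N : ℕ) {x : ℝ} (hx : |x| ≤ 1 / 2) :
    ∃ k : ℕ, (N + 1) * |x| ≤ 2 ^ k ∧ ‖fejerKer1 N x‖ ≤ (N + 1) / 4 ^ k := by
  have hex : ∃ k : ℕ, (N + 1) * |x| ≤ 2 ^ k :=
    (pow_unbounded_of_one_lt ((N + 1) * |x|) one_lt_two).imp fun _ h => h.le
  classical
  -- The least such `k`: minimality bounds `2 ^ (k - 1)` by `(N + 1) |x|` when `k > 0`.
  refine ⟨Nat.find hex, Nat.find_spec hex, ?_⟩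
  rcases hk : Nat.find hex with _ | k
  · simpa using norm_fejerKer1_le N x
  · have hlt : (2 : ℝ) ^ k < (N + 1) * |x| := not_le.1 (Nat.find_min hex (by omega))
    have h := norm_fejerKer1_mul_sq_le N hx
    have h0 : (0 : ℝ) < N + 1 := by positivity
    rw [le_div_iff₀ (by positivity)]
    have h1 : (2 : ℝ) ^ k * 2 ^ k ≤ ((N + 1) * |x|) * ((N + 1) * |x|) := by gcongr
    have h2 : |x| * |x| = x ^ 2 := by rw [abs_mul_abs_self]; ring
    have h3 : (4 : ℝ) ^ (k + 1) ≤ 4 * ((N + 1) * x ^ 2) * (N + 1) := by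
      have : (4 : ℝ) ^ k = 2 ^ k * 2 ^ k := by rw [← mul_pow]; norm_num
      rw [pow_succ, this, ← h2]
      nlinarith
    calc ‖fejerKer1 N x‖ * 4 ^ (k + 1)
        ≤ ‖fejerKer1 N x‖ * (4 * ((N + 1) * x ^ 2) * (N + 1)) := by gcongr
      _ = ‖fejerKer1 N x‖ * (4 * ((N + 1) * x ^ 2)) * (N + 1) := by ring
      _ ≤ 1 * (N + 1) := by gcongr
      _ = N + 1 := one_mul _

theorem fejerKer1_add_intCast (N : ℕ) (x : ℝ) (l : ℤ) : fejerKer1 N (x + l) = fejerKer1 N x := by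
  unfold fejerKer1 dirichletKer
  congr 1
  refine Finset.sum_congr rfl fun k _ => Finset.sum_congr rfl fun m _ => ?_
  rw [show (2 * Real.pi * Complex.I * m * ((x + l : ℝ) : ℂ) : ℂ)
    = 2 * Real.pi * Complex.I * m * x + ((m * l : ℤ) : ℂ) * (2 * Real.pi * Complex.I) by
      push_cast; ring, Complex.exp_add, Complex.exp_int_mul_two_pi_mul_I, mul_one]

@[fun_prop]
theorem continuous_fejerKer1 (N : ℕ) : Continuous (fejerKer1 N) := by
  unfold fejerKer1 dirichletKer
  fun_prop

@[fun_prop]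
theorem continuous_fejerKer (n N : ℕ) : Continuous (fejerKer n N) := by
  unfold fejerKer
  fun_prop

theorem norm_fejerKer_le (n N : ℕ) (x : Fin n → ℝ) : ‖fejerKer n N x‖ ≤ (N + 1) ^ n := by
  rw [fejerKer, norm_prod]
  refine (Finset.prod_le_prod (fun _ _ => norm_nonneg _)
    fun j _ => norm_fejerKer1_le N (x j)).trans ?_
  simp

theorem norm_chirp {n : ℕ} (α : ℝ) (x : Fin n → ℝ) : ‖chirp α x‖ = 1 := by
  rw [chirp, Complex.norm_exp_ofReal_mul_I]

theorem chirp_mul_chirp_neg {n : ℕ} (α : ℝ) (x : Fin n → ℝ) : chirp α x * chirp (-α) x = 1 := by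
  rw [chirp, chirp, ← Complex.exp_add, ← Complex.exp_zero]
  congr 1
  rw [Real.cot_eq_cos_div_sin, Real.cot_eq_cos_div_sin, Real.cos_neg, Real.sin_neg]
  push_cast
  ring

@[fun_prop]
theorem continuous_chirp {n : ℕ} (α : ℝ) : Continuous (chirp α : (Fin n → ℝ) → ℂ) := by
  unfold chirp
  fun_prop

/-! ### Maximal functions over dyadic boxes -/

theorem ENNReal.tsum_prod_fin (n : ℕ) (f : ℕ → ℝ≥0∞) :
    ∑' k : Fin n → ℕ, ∏ j, f (k j) = (∑' i, f i) ^ n := by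
  induction n with
  | zero => simp
  | succ n ih =>
    rw [← (Fin.consEquiv (fun _ : Fin (n + 1) => ℕ)).tsum_eq, ENNReal.tsum_prod']
    simp only [Fin.consEquiv_apply, Fin.prod_univ_succ, Fin.cons_zero, Fin.cons_succ,
      ENNReal.tsum_mul_left, ENNReal.tsum_mul_right, ih]
    rw [pow_succ']

theorem ENNReal.tsum_prod_pow_ne_top (n : ℕ) (c : ℝ≥0) {q : ℝ≥0} (hq : q < 1) :
    ∑' k : Fin n → ℕ, ∏ j, ((c * q ^ k j : ℝ≥0) : ℝ≥0∞) ≠ ∞ := by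
  rw [ENNReal.tsum_prod_fin n fun i => ((c * q ^ i : ℝ≥0) : ℝ≥0∞)]
  refine ENNReal.pow_ne_top ?_
  rw [ENNReal.tsum_coe_ne_top_iff_summable]
  exact (NNReal.summable_geometric hq).mul_left c

/-- The closed box with centre `x` and half-sides `2 ^ k j * r`. -/
def dyadicBox {n : ℕ} (r : ℝ) (k : Fin n → ℕ) (x : Fin n → ℝ) : Set (Fin n → ℝ) :=
  Set.Icc (fun j => x j - 2 ^ k j * r) (fun j => x j + 2 ^ k j * r)

section
variable {n : ℕ}

theorem mem_dyadicBox {r : ℝ} {k : Fin n → ℕ} {x y : Fin n → ℝ} :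
    y ∈ dyadicBox r k x ↔ ∀ j, |x j - y j| ≤ 2 ^ k j * r := by
  simp only [dyadicBox, Set.mem_Icc, Pi.le_def, ← forall_and]
  refine forall_congr' fun j => ?_
  rw [abs_le]
  constructor <;> rintro ⟨h1, h2⟩ <;> constructor <;> linarith

theorem measurableSet_dyadicBox (r : ℝ) (k : Fin n → ℕ) (x : Fin n → ℝ) :
    MeasurableSet (dyadicBox r k x) := measurableSet_Icc

theorem volume_dyadicBox (r : ℝ) (k : Fin n → ℕ) (x : Fin n → ℝ) :
    volume (dyadicBox r k x) = ∏ j, ENNReal.ofReal (2 * 2 ^ k j * r) := by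
  rw [dyadicBox, Real.volume_Icc_pi]
  refine Finset.prod_congr rfl fun j _ => ?_
  congr 1
  ring

theorem volume_dyadicBox_three_mul (r : ℝ) (k : Fin n → ℕ) (x : Fin n → ℝ) :
    volume (dyadicBox (3 * r) k x) = 3 ^ n * volume (dyadicBox r k x) := by
  have : (3 : ℝ≥0∞) ^ n = ∏ _j : Fin n, (3 : ℝ≥0∞) := by simp
  rw [volume_dyadicBox, volume_dyadicBox, this, ← Finset.prod_mul_distrib]
  refine Finset.prod_congr rfl fun j _ => ?_
  rw [show 2 * 2 ^ k j * (3 * r) = 3 * (2 * 2 ^ k j * r) by ring,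
    ENNReal.ofReal_mul (by norm_num)]
  norm_num

/-- Weak type `(1,1)` bound for the maximal function over boxes of a fixed shape `k`, uniform in
`k`. Boxes of one shape are the balls of a norm, so the Vitali covering argument gives the
constant `3 ^ n` whatever the eccentricity. -/
theorem mul_volume_exists_dyadicBox_le {r : ℕ → ℝ} (hr : ∀ N, 0 < r N) {R : ℝ} (hR : ∀ N, r N ≤ R)
    (k : Fin n → ℕ) (H : (Fin n → ℝ) → ℝ≥0∞) (t : ℝ≥0∞) :
    t * volume {x | ∃ N, t * volume (dyadicBox (r N) k x) < ∫⁻ y in dyadicBox (r N) k x, H y}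
      ≤ 3 ^ n * ∫⁻ y, H y := by
  obtain ⟨u, hut, hdisj, hcov⟩ := Vitali.exists_disjoint_subfamily_covering_enlargement
    (fun a : (Fin n → ℝ) × ℕ => dyadicBox (r a.2) k a.1)
    {a | t * volume (dyadicBox (r a.2) k a.1) < ∫⁻ y in dyadicBox (r a.2) k a.1, H y}
    (fun a => r a.2) 2 one_lt_two (fun a _ => (hr _).le) R (fun a _ => hR _)
    (fun a _ => ⟨a.1, mem_dyadicBox.2 fun j => by
      have := hr a.2
      rw [sub_self, abs_zero]; positivity⟩)
  have hcount : u.Countable := by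
    refine hdisj.countable_of_nonempty_interior fun a _ => ?_
    have h := hr a.2
    refine ⟨a.1, mem_interior_iff_mem_nhds.2 (pi_Icc_mem_nhds (fun j => ?_) fun j => ?_)⟩
    · exact sub_lt_self _ (by positivity)
    · exact lt_add_of_pos_right _ (by positivity)
  have hsub : {x | ∃ N, t * volume (dyadicBox (r N) k x) < ∫⁻ y in dyadicBox (r N) k x, H y}
      ⊆ ⋃ a ∈ u, dyadicBox (3 * r a.2) k a.1 := by
    rintro x ⟨N, hN⟩
    obtain ⟨b, hbu, ⟨z, hz1, hz2⟩, hδ⟩ := hcov (x, N) hN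
    simp only [Set.mem_iUnion]
    refine ⟨b, hbu, mem_dyadicBox.2 fun j => ?_⟩
    have h1 := mem_dyadicBox.1 hz1 j
    have h2 := mem_dyadicBox.1 hz2 j
    simp only at h1 h2 hδ
    have h3 : |b.1 j - x j| ≤ |b.1 j - z j| + |x j - z j| := by
      rw [abs_sub_comm (x j)]
      exact abs_sub_le _ _ _
    have h4 : (2 : ℝ) ^ k j * r N ≤ 2 ^ k j * (2 * r b.2) := by gcongr
    linarith
  -- Only the centres have to be covered, hence the dilation factor `1 + τ = 3` instead of `1 + 2τ`.
  have := hcount.to_subtype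
  calc t * volume {x | ∃ N, t * volume (dyadicBox (r N) k x) < ∫⁻ y in dyadicBox (r N) k x, H y}
      ≤ t * ∑' a : u, volume (dyadicBox (3 * r a.1.2) k a.1.1) := by
        gcongr
        exact (measure_mono hsub).trans (measure_biUnion_le _ hcount _)
    _ = 3 ^ n * ∑' a : u, t * volume (dyadicBox (r a.1.2) k a.1.1) := by
        simp_rw [volume_dyadicBox_three_mul, ENNReal.tsum_mul_left]
        ring
    _ ≤ 3 ^ n * ∑' a : u, ∫⁻ y in dyadicBox (r a.1.2) k a.1.1, H y := by
        gcongr with a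
        exact (hut a.2).le
    _ = 3 ^ n * ∫⁻ y in ⋃ a ∈ u, dyadicBox (r a.2) k a.1, H y := by
        rw [lintegral_biUnion hcount (fun a _ => measurableSet_dyadicBox _ _ _) hdisj]
    _ ≤ 3 ^ n * ∫⁻ y, H y := by
        gcongr
        exact Measure.restrict_le_self

/-- The weight `∏ 2 · 2⁻ᵏʲ` carried by the box of shape `k` in the dyadic decomposition of the
Fejér kernel. -/
noncomputable def boxWeight (k : Fin n → ℕ) : ℝ≥0∞ := ∏ j, ((2 * (1 / 2) ^ k j : ℝ≥0) : ℝ≥0∞)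

theorem tsum_boxWeight_ne_top (n : ℕ) : ∑' k : Fin n → ℕ, boxWeight k ≠ ∞ :=
  ENNReal.tsum_prod_pow_ne_top n 2 (by rw [div_lt_one (by norm_num)]; norm_num)

/-- The maximal operator majorizing the Fejér means: the supremum over `N` of the weighted sums,
over all shapes `k`, of the averages over boxes with half-sides `2 ^ k j * s / (N + 1)`. -/
noncomputable def boxMaximal (s : ℝ) (H : (Fin n → ℝ) → ℝ≥0∞) (x : Fin n → ℝ) : ℝ≥0∞ :=
  ⨆ N : ℕ, ∑' k : Fin n → ℕ, boxWeight k * ((volume (dyadicBox (s / (N + 1)) k x))⁻¹ *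
    ∫⁻ y in dyadicBox (s / (N + 1)) k x, H y)

/-- Weak type `(1,1)` of `boxMaximal`. The quasi-norm of weak `L¹` is not countably subadditive;
the geometric decay of the weights is split as `1/2 = 3/4 · 2/3`, one factor to distribute the
level `t` among the shapes, the other to sum the resulting bounds. -/
theorem exists_mul_volume_boxMaximal_le (n : ℕ) : ∃ C : ℝ≥0, ∀ s : ℝ, 0 < s →
    ∀ (H : (Fin n → ℝ) → ℝ≥0∞) (t : ℝ≥0∞),
      t * volume {x | t < boxMaximal s H x} ≤ C * ∫⁻ y, H y := by
  set a : (Fin n → ℕ) → ℝ≥0∞ := fun k => ∏ j, ((1 * (3 / 4) ^ k j : ℝ≥0) : ℝ≥0∞) with ha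
  set b : (Fin n → ℕ) → ℝ≥0∞ := fun k => ∏ j, ((2 * (2 / 3) ^ k j : ℝ≥0) : ℝ≥0∞) with hb
  have hA : ∑' k, a k ≠ ∞ := ENNReal.tsum_prod_pow_ne_top n 1 (by
    rw [div_lt_one (by norm_num)]; norm_num)
  have hB : ∑' k, b k ≠ ∞ := ENNReal.tsum_prod_pow_ne_top n 2 (by
    rw [div_lt_one (by norm_num)]; norm_num)
  have hA0 : ∑' k, a k ≠ 0 := by
    intro h
    have := ENNReal.tsum_eq_zero.1 h 0
    simp [ha] at this
  have hab : ∀ k : Fin n → ℕ, boxWeight k = a k * b k := by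
    intro k
    rw [boxWeight, ha, hb, ← Finset.prod_mul_distrib]
    refine Finset.prod_congr rfl fun j _ => ?_
    rw [← ENNReal.coe_mul]
    congr 1
    rw [show (1 / 2 : ℝ≥0) = 3 / 4 * (2 / 3) by ext; push_cast; norm_num, mul_pow]
    ring
  have hbt : ∀ k, b k ≠ ∞ := fun k => ENNReal.prod_ne_top fun _ _ => ENNReal.coe_ne_top
  refine ⟨((∑' k, a k) * (∑' k, b k) * 3 ^ n).toNNReal, fun s hs H t => ?_⟩
  rw [ENNReal.coe_toNNReal (by finiteness)]
  set A := ∑' k, a k with hAdef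
  -- If every average over boxes of shape `k` were at most `τ / b k`, their sum with the weights
  -- `a k * b k` would be at most `A * τ = t`.
  set τ := t / A with hτ
  have htτ : t = A * τ := by rw [hτ, ENNReal.mul_div_cancel hA0 hA]
  have hsub : {x | t < boxMaximal s H x} ⊆ ⋃ k, {x | ∃ N : ℕ,
      τ * volume (dyadicBox (s / (N + 1)) k x) < ∫⁻ y in dyadicBox (s / (N + 1)) k x,
        b k * H y} := by
    intro x hx
    by_contra hcon
    simp only [Set.mem_iUnion, Set.mem_ofPred_eq, not_exists, not_lt] at hcon
    have hx' : t < boxMaximal s H x := hx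
    refine hx'.not_ge (iSup_le fun N => ?_)
    rw [htτ, hAdef, ← ENNReal.tsum_mul_right]
    refine ENNReal.tsum_le_tsum fun k => ?_
    have h := hcon k N
    rw [lintegral_const_mul' _ _ (hbt k)] at h
    set V := volume (dyadicBox (s / (N + 1)) k x)
    calc boxWeight k * (V⁻¹ * ∫⁻ y in dyadicBox (s / (N + 1)) k x, H y)
        = a k * (V⁻¹ * (b k * ∫⁻ y in dyadicBox (s / (N + 1)) k x, H y)) := by rw [hab]; ring
      _ ≤ a k * (V⁻¹ * (τ * V)) := by gcongr
      _ = a k * (τ * (V⁻¹ * V)) := by ring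
      _ ≤ a k * (τ * 1) := by
          gcongr
          exact ENNReal.inv_mul_le_one _
      _ = a k * τ := by rw [mul_one]
  calc t * volume {x | t < boxMaximal s H x}
      ≤ t * ∑' k, volume {x | ∃ N : ℕ, τ * volume (dyadicBox (s / (N + 1)) k x)
          < ∫⁻ y in dyadicBox (s / (N + 1)) k x, b k * H y} := by
        gcongr
        exact (measure_mono hsub).trans (measure_iUnion_le _)
    _ = A * ∑' k, τ * volume {x | ∃ N : ℕ, τ * volume (dyadicBox (s / (N + 1)) k x)
          < ∫⁻ y in dyadicBox (s / (N + 1)) k x, b k * H y} := by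
        rw [ENNReal.tsum_mul_left, htτ]
        ring
    _ ≤ A * ∑' k, 3 ^ n * ∫⁻ y, b k * H y := by
        gcongr A * ?_
        refine ENNReal.tsum_le_tsum fun k => ?_
        refine mul_volume_exists_dyadicBox_le (r := fun N : ℕ => s / (N + 1))
          (fun N => by positivity) (R := s) (fun N => ?_) k _ τ
        exact div_le_self hs.le (by linarith [N.cast_nonneg (α := ℝ)])
    _ = A * (∑' k, b k) * 3 ^ n * ∫⁻ y, H y := by
        simp_rw [lintegral_const_mul' _ _ (hbt _), ENNReal.tsum_mul_left, ENNReal.tsum_mul_right]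
        ring

theorem average_dyadicBox_le (r : ℝ) (k : Fin n → ℕ) (x : Fin n → ℝ) (t : ℝ≥0∞) :
    (volume (dyadicBox r k x))⁻¹ * ∫⁻ _ in dyadicBox r k x, t ≤ t := by
  rw [setLIntegral_const, mul_left_comm]
  calc _ ≤ t * 1 := by gcongr; exact ENNReal.inv_mul_le_one _
    _ = t := mul_one t

theorem boxMaximal_le_of_ae_le (s : ℝ) {H : (Fin n → ℝ) → ℝ≥0∞} {t : ℝ≥0∞}
    (hH : ∀ᵐ y, H y ≤ t) (x : Fin n → ℝ) :
    boxMaximal s H x ≤ (∑' k : Fin n → ℕ, boxWeight k) * t := by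
  refine iSup_le fun N => ?_
  rw [← ENNReal.tsum_mul_right]
  refine ENNReal.tsum_le_tsum fun k => ?_
  gcongr
  refine le_trans ?_ (average_dyadicBox_le (s / (N + 1)) k x t)
  gcongr _ * ?_
  exact lintegral_mono_ae (ae_restrict_of_ae hH)

/-- The part of `H` below the level `t` contributes at most a multiple of `t`. -/
theorem boxMaximal_le_add (s : ℝ) (H : (Fin n → ℝ) → ℝ≥0∞) (t : ℝ≥0∞) (x : Fin n → ℝ) :
    boxMaximal s H x ≤ boxMaximal s ({y | t < H y}.indicator H) x
      + (∑' k : Fin n → ℕ, boxWeight k) * t := by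
  refine iSup_le fun N => ?_
  refine le_trans ?_ (add_le_add_left (le_iSup _ N) _)
  rw [← ENNReal.tsum_mul_right, ← ENNReal.tsum_add]
  refine ENNReal.tsum_le_tsum fun k => ?_
  rw [← mul_add]
  gcongr
  calc (volume (dyadicBox (s / (N + 1)) k x))⁻¹ * ∫⁻ y in dyadicBox (s / (N + 1)) k x, H y
      ≤ (volume (dyadicBox (s / (N + 1)) k x))⁻¹ * ∫⁻ y in dyadicBox (s / (N + 1)) k x,
          ({y | t < H y}.indicator H y + t) := by
        gcongr with y
        by_cases hy : t < H y
        · rw [Set.indicator_of_mem (by exact hy)]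
          exact le_self_add
        · exact (not_lt.1 hy).trans le_add_self
    _ ≤ _ := by
        rw [lintegral_add_right _ measurable_const, mul_add]
        gcongr
        exact average_dyadicBox_le _ _ _ _

/-- Truncated weak type bound: only the part of `H` comparable with the level contributes. -/
theorem exists_mul_volume_boxMaximal_le_setLIntegral (n : ℕ) : ∃ A C : ℝ≥0, ∀ s : ℝ,
    0 < s → ∀ (H : (Fin n → ℝ) → ℝ≥0∞) (t : ℝ≥0∞),
      t * volume {x | t < boxMaximal s H x} ≤ C * ∫⁻ y in {y | t < A * H y}, A * H y := by
  obtain ⟨C, hC⟩ := exists_mul_volume_boxMaximal_le n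
  set W := ∑' k : Fin n → ℕ, boxWeight k with hWdef
  have hW : W ≠ ∞ := tsum_boxWeight_ne_top n
  refine ⟨W.toNNReal + 1, C, fun s hs H t => ?_⟩
  have hA : ((W.toNNReal + 1 : ℝ≥0) : ℝ≥0∞) = W + 1 := by
    rw [ENNReal.coe_add, ENNReal.coe_toNNReal hW, ENNReal.coe_one]
  rw [hA]
  have hA0 : W + 1 ≠ 0 := by simp
  have hA1 : W + 1 ≠ ∞ := by finiteness
  set τ := t / (W + 1) with hτ
  have ht : t = (W + 1) * τ := by rw [hτ, ENNReal.mul_div_cancel hA0 hA1]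
  have hset : {y | t < (W + 1) * H y} = {y | τ < H y} := by
    ext y
    rw [Set.mem_ofPred_eq, Set.mem_ofPred_eq, ht, ENNReal.mul_lt_mul_iff_right hA0 hA1]
  rw [hset, lintegral_const_mul' _ _ hA1]
  calc t * volume {x | t < boxMaximal s H x}
      ≤ t * volume {x | τ < boxMaximal s ({y | τ < H y}.indicator H) x} := by
        gcongr t * volume ?_
        intro x hx
        by_contra hcon
        refine hx.not_ge ((boxMaximal_le_add s H τ x).trans ?_)
        rw [ht, add_mul, one_mul, add_comm]
        gcongr
        exact not_lt.1 hcon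
    _ = (W + 1) * (τ * volume {x | τ < boxMaximal s ({y | τ < H y}.indicator H) x}) := by
        nth_rw 1 [ht]
        ring
    _ ≤ (W + 1) * (C * ∫⁻ y, {y | τ < H y}.indicator H y) := by
        gcongr _ * ?_
        exact hC s hs _ τ
    _ ≤ (W + 1) * (C * ∫⁻ y in {y | τ < H y}, H y) := by
        gcongr _ * (_ * ?_)
        exact lintegral_indicator_le _ _
    _ = C * ((W + 1) * ∫⁻ y in {y | τ < H y}, H y) := by ring

end

/-! ### Marcinkiewicz interpolation -/

/-- Marcinkiewicz interpolation in the form used here: a truncated weak type `(1,1)` bound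
integrates to a strong type `(p,p)` bound. The layer-cake formula is used twice, for `G` and,
with respect to the measure `f ν`, for `f`. -/
theorem lintegral_rpow_le_of_weak_type {α β : Type*} [MeasurableSpace α] [MeasurableSpace β]
    {μ : Measure α} {ν : Measure β} {G : α → ℝ≥0∞} {f : β → ℝ} (hG : AEMeasurable G μ)
    (hGtop : ∀ᵐ x ∂μ, G x < ∞) (hf : Measurable f) (hf0 : ∀ y, 0 ≤ f y) {C : ℝ≥0∞}
    (hC : C ≠ ∞)
    (hw : ∀ t : ℝ, 0 < t → ENNReal.ofReal t * μ {x | ENNReal.ofReal t < G x}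
      ≤ C * ∫⁻ y in {y | t < f y}, ENNReal.ofReal (f y) ∂ν) {p : ℝ} (hp : 1 < p) :
    ∫⁻ x, G x ^ p ∂μ
      ≤ C * ENNReal.ofReal (p / (p - 1)) * ∫⁻ y, ENNReal.ofReal (f y) ^ p ∂ν := by
  have hp0 : 0 < p := by linarith
  have hp1 : 0 < p - 1 := by linarith
  have h1 : ∫⁻ x, G x ^ p ∂μ = ∫⁻ x, ENNReal.ofReal ((G x).toReal ^ p) ∂μ := by
    refine lintegral_congr_ae (hGtop.mono fun x hx => ?_)
    simp only
    rw [← ENNReal.ofReal_rpow_of_nonneg ENNReal.toReal_nonneg hp0.le,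
      ENNReal.ofReal_toReal hx.ne]
  rw [h1, lintegral_rpow_eq_lintegral_meas_lt_mul μ
    (Eventually.of_forall fun x => ENNReal.toReal_nonneg) hG.ennreal_toReal hp0]
  set ν' := ν.withDensity fun y => ENNReal.ofReal (f y) with hν'
  have h2 := lintegral_rpow_eq_lintegral_meas_lt_mul ν' (f := f) (Eventually.of_forall hf0)
    hf.aemeasurable hp1
  have h3 : ∫⁻ y, ENNReal.ofReal (f y ^ (p - 1)) ∂ν' = ∫⁻ y, ENNReal.ofReal (f y) ^ p ∂ν := by
    rw [hν', lintegral_withDensity_eq_lintegral_mul _ (by fun_prop) (by fun_prop)]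
    refine lintegral_congr fun y => ?_
    rw [Pi.mul_apply, ENNReal.ofReal_rpow_of_nonneg (hf0 y) hp0.le, ← ENNReal.ofReal_mul (hf0 y)]
    congr 1
    rcases (hf0 y).eq_or_lt with h | h
    · rw [← h, Real.zero_rpow hp0.ne', zero_mul]
    · rw [Real.rpow_sub h, Real.rpow_one]
      field_simp
  rw [h3] at h2
  set J := ∫⁻ t in Set.Ioi (0 : ℝ), ν' {y | t < f y} * ENNReal.ofReal (t ^ (p - 1 - 1)) with hJ
  calc ENNReal.ofReal p * ∫⁻ t in Set.Ioi (0 : ℝ), μ {x | t < (G x).toReal} *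
        ENNReal.ofReal (t ^ (p - 1))
      ≤ ENNReal.ofReal p * ∫⁻ t in Set.Ioi (0 : ℝ), C * (ν' {y | t < f y} *
        ENNReal.ofReal (t ^ (p - 1 - 1))) := by
        gcongr _ * ?_
        refine setLIntegral_mono' measurableSet_Ioi fun t ht => ?_
        have ht0 : (0 : ℝ) < t := ht
        have h4 : t ^ (p - 1) = t * t ^ (p - 1 - 1) := by
          rw [Real.rpow_sub ht0 (p - 1), Real.rpow_one]
          field_simp
        rw [h4, ENNReal.ofReal_mul ht0.le, ← mul_assoc, ← mul_assoc]
        gcongr ?_ * _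
        rw [hν', withDensity_apply _ (measurableSet_lt measurable_const hf), mul_comm]
        refine le_trans ?_ (hw t ht0)
        gcongr with x
        exact fun hx => ((ENNReal.ofReal_lt_ofReal_iff_of_nonneg ht0.le).2 hx).trans_le
          ENNReal.ofReal_toReal_le
    _ = ENNReal.ofReal p * (C * J) := by rw [lintegral_const_mul' _ _ hC]
    _ = C * ENNReal.ofReal (p / (p - 1)) * (ENNReal.ofReal (p - 1) * J) := by
        rw [ENNReal.ofReal_div_of_pos hp1]
        have : ENNReal.ofReal (p - 1) ≠ 0 := by simpa using hp1
        calc ENNReal.ofReal p * (C * J)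
            = C * (ENNReal.ofReal p / ENNReal.ofReal (p - 1) * ENNReal.ofReal (p - 1)) * J := by
              rw [ENNReal.div_mul_cancel this ENNReal.ofReal_ne_top]; ring
          _ = _ := by ring
    _ = _ := by rw [h2]

/-! ### Domination of the Fejér means -/

section
variable {n : ℕ}

theorem measurableSet_fracCube (n : ℕ) (α : ℝ) : MeasurableSet (fracCube n α) := measurableSet_Icc

instance (n : ℕ) (α : ℝ) : IsFiniteMeasure (torusMeasure n α) :=
  ⟨by
    rw [torusMeasure, Measure.restrict_apply_univ, fracCube]
    exact measure_Icc_lt_top⟩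

/-- The finitely many translates `s • l`, `l ∈ {-1, 0, 1} ^ n`, needed to see the periodic
extension from points of the cube. -/
noncomputable def neighbours (n : ℕ) : Finset (Fin n → ℤ) := Fintype.piFinset fun _ => Finset.Icc (-1) 1

/-- The periodic extension of `|f|`, cut off outside three periods in every coordinate. -/
noncomputable def periodized (α : ℝ) (f : (Fin n → ℝ) → ℂ) (y : Fin n → ℝ) : ℝ≥0∞ :=
  ∑ l ∈ neighbours n, (fracCube n α).indicator (fun z => ‖f z‖ₑ)
    (y - fun j => |Real.sin α| * (l j : ℝ))

theorem measurable_indicator_enorm (α : ℝ) {f : (Fin n → ℝ) → ℂ} (hf : StronglyMeasurable f) :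
    Measurable ((fracCube n α).indicator fun z => ‖f z‖ₑ) :=
  hf.measurable.enorm.indicator (measurableSet_fracCube n α)

theorem measurable_periodized (α : ℝ) {f : (Fin n → ℝ) → ℂ} (hf : StronglyMeasurable f) :
    Measurable (periodized α f) :=
  Finset.measurable_fun_sum _ fun _ _ =>
    (measurable_indicator_enorm α hf).comp (measurable_id.sub_const _)

theorem periodized_lt_top (α : ℝ) (f : (Fin n → ℝ) → ℂ) (y : Fin n → ℝ) :
    periodized α f y < ∞ := by
  refine ENNReal.sum_lt_top.2 fun l _ => ?_
  refine lt_of_le_of_lt (Set.indicator_le_self _ _ _) ?_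
  exact enorm_lt_top

theorem eLpNorm_periodized_le (α : ℝ) {f : (Fin n → ℝ) → ℂ} (hf : StronglyMeasurable f)
    {p : ℝ≥0∞} (hp : 1 ≤ p) :
    eLpNorm (periodized α f) p volume ≤ (neighbours n).card * eLpNorm f p (torusMeasure n α) := by
  have h : periodized α f = ∑ l ∈ neighbours n, fun y =>
      (fracCube n α).indicator (fun z => ‖f z‖ₑ) (y - fun j => |Real.sin α| * (l j : ℝ)) := by
    ext y
    rw [periodized, Finset.sum_apply]
  rw [h]
  refine (eLpNorm_sum_le (fun l _ => ((measurable_indicator_enorm α hf).comp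
    (measurable_id.sub_const _)).aestronglyMeasurable) hp).trans ?_
  rw [← nsmul_eq_mul]
  refine Finset.sum_le_card_nsmul _ _ _ fun l _ => ?_
  refine le_of_eq ?_
  have h1 := eLpNorm_comp_measurePreserving (p := p)
    (measurable_indicator_enorm α hf).aestronglyMeasurable
    (measurePreserving_sub_right (volume : Measure (Fin n → ℝ))
      (fun j => |Real.sin α| * (l j : ℝ)))
  refine h1.trans ?_
  rw [eLpNorm_indicator_eq_eLpNorm_restrict (measurableSet_fracCube n α)]
  exact eLpNorm_enorm f

/-- One factor of the kernel domination. The integer `l` moves `y` to the representative closest to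
`x` modulo `c`, and the right-hand side is the factor of `boxWeight k` over the side of the box. -/
theorem exists_norm_fejerKer1_div_le {c : ℝ} (hc : c ≠ 0) (N : ℕ) {x y : ℝ}
    (hx : |x| ≤ |c| / 2) (hy : |y| ≤ |c| / 2) :
    ∃ l ∈ Finset.Icc (-1 : ℤ) 1, ∃ k : ℕ,
      |x - (y + |c| * l)| ≤ 2 ^ k * (|c| / (N + 1)) ∧
      |c⁻¹| * ‖fejerKer1 N ((x - y) * c⁻¹)‖ ≤ 2 * (1 / 2) ^ k * (2 * 2 ^ k * (|c| / (N + 1)))⁻¹ := by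
  have hc' : 0 < |c| := abs_pos.2 hc
  obtain ⟨l, hl, hd⟩ : ∃ l ∈ Finset.Icc (-1 : ℤ) 1, |x - (y + |c| * l)| ≤ |c| / 2 := by
    rw [abs_le] at hx hy
    rcases lt_or_ge (x - y) (-(|c| / 2)) with h | h
    · exact ⟨-1, by simp, by rw [abs_le]; push_cast; constructor <;> linarith⟩
    rcases lt_or_ge (|c| / 2) (x - y) with h' | h'
    · exact ⟨1, by simp, by rw [abs_le]; push_cast; constructor <;> linarith⟩
    · exact ⟨0, by simp, by rw [abs_le]; push_cast; constructor <;> linarith⟩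
  set d := x - (y + |c| * l) with hddef
  obtain ⟨l', hl'⟩ : ∃ l' : ℤ, |c| * c⁻¹ * l = l' := by
    rcases abs_cases c with ⟨h, _⟩ | ⟨h, _⟩ <;> rw [h]
    · exact ⟨l, by rw [mul_inv_cancel₀ hc, one_mul]⟩
    · exact ⟨-l, by rw [neg_mul, mul_inv_cancel₀ hc]; push_cast; ring⟩
  have hF : fejerKer1 N ((x - y) * c⁻¹) = fejerKer1 N (d * c⁻¹) := by
    rw [← fejerKer1_add_intCast N (d * c⁻¹) l', ← hl', hddef]
    congr 1
    ring
  have habs : |d * c⁻¹| = |d| / |c| := by rw [abs_mul, abs_inv, div_eq_mul_inv]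
  obtain ⟨k, hk1, hk2⟩ := exists_norm_fejerKer1_le N (x := d * c⁻¹) (by
    rw [habs, div_le_iff₀ hc']; linarith)
  refine ⟨l, hl, k, ?_, ?_⟩
  · rw [habs] at hk1
    rw [← mul_div_assoc, le_div_iff₀ (by positivity)]
    rw [← mul_div_assoc, div_le_iff₀ hc'] at hk1
    linarith
  · rw [hF, abs_inv]
    calc |c|⁻¹ * ‖fejerKer1 N (d * c⁻¹)‖ ≤ |c|⁻¹ * ((N + 1) / 4 ^ k) := by gcongr
      _ = _ := by
        rw [show (4 : ℝ) ^ k = 2 ^ k * 2 ^ k by rw [← mul_pow]; norm_num, one_div, inv_pow]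
        field_simp

/-- The Fejér kernel is dominated by normalized indicators of dyadic boxes. -/
theorem enorm_fejerKer_le {α : ℝ} (hα : Real.sin α ≠ 0) (N : ℕ) {x y : Fin n → ℝ}
    (hx : x ∈ fracCube n α) (hy : y ∈ fracCube n α) :
    ‖(Real.sin α)⁻¹‖ₑ ^ n * ‖fejerKer n N fun i => (x i - y i) * (Real.sin α)⁻¹‖ₑ ≤
      ∑ l ∈ neighbours n, ∑' k : Fin n → ℕ,
        boxWeight k * (volume (dyadicBox (|Real.sin α| / (N + 1)) k x))⁻¹ *
          (dyadicBox (|Real.sin α| / (N + 1)) k x).indicator 1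
            (y + fun j => |Real.sin α| * (l j : ℝ)) := by
  have hs : 0 < |Real.sin α| := abs_pos.2 hα
  have hr : 0 < |Real.sin α| / (N + 1) := by positivity
  have hx' : ∀ j, |x j| ≤ |Real.sin α| / 2 := fun j => abs_le.2 ⟨hx.1 j, hx.2 j⟩
  have hy' : ∀ j, |y j| ≤ |Real.sin α| / 2 := fun j => abs_le.2 ⟨hy.1 j, hy.2 j⟩
  choose l hl k hk1 hk2 using fun j => exists_norm_fejerKer1_div_le hα N (hx' j) (hy' j)
  refine le_trans ?_ (Finset.single_le_sum (fun _ _ => zero_le)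
    (Fintype.mem_piFinset.2 hl : l ∈ neighbours n))
  refine le_trans ?_ (ENNReal.le_tsum k)
  have hmem : (y + fun j => |Real.sin α| * (l j : ℝ)) ∈ dyadicBox (|Real.sin α| / (N + 1)) k x :=
    mem_dyadicBox.2 hk1
  rw [Set.indicator_of_mem hmem, Pi.one_apply, mul_one, volume_dyadicBox,
    boxWeight, ENNReal.prod_inv_distrib (by
      intro i _ j _ _
      exact Or.inr ENNReal.ofReal_ne_top), ← Finset.prod_mul_distrib]
  have h1 : ‖(Real.sin α)⁻¹‖ₑ ^ n = ∏ _j : Fin n, ‖(Real.sin α)⁻¹‖ₑ := by simp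
  have h2 : ‖fejerKer n N fun i => (x i - y i) * (Real.sin α)⁻¹‖ₑ
      = ∏ j, ‖fejerKer1 N ((x j - y j) * (Real.sin α)⁻¹)‖ₑ := by
    simp only [fejerKer, ← ofReal_norm, norm_prod]
    rw [ENNReal.ofReal_prod_of_nonneg fun _ _ => norm_nonneg _]
  rw [h1, h2, ← Finset.prod_mul_distrib]
  refine Finset.prod_le_prod' fun j _ => ?_
  rw [← ofReal_norm, ← ofReal_norm, ← ENNReal.ofReal_mul (norm_nonneg _),
    Real.norm_eq_abs]
  refine (ENNReal.ofReal_le_ofReal (hk2 j)).trans (le_of_eq ?_)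
  rw [ENNReal.ofReal_mul (by positivity), ENNReal.ofReal_inv_of_pos (by positivity)]
  congr 1
  rw [ENNReal.ofReal, Real.toNNReal_of_nonneg (by positivity)]
  congr 1

theorem enorm_fejerMean_le (α : ℝ) (f : (Fin n → ℝ) → ℂ) (N : ℕ) (x : Fin n → ℝ) :
    ‖fejerMean α N f x‖ₑ ≤ ∫⁻ y in fracCube n α, ‖f y‖ₑ *
      (‖(Real.sin α)⁻¹‖ₑ ^ n * ‖fejerKer n N fun i => (x i - y i) * (Real.sin α)⁻¹‖ₑ) := by
  have h1 : ∀ y : Fin n → ℝ, ‖chirp α y‖ₑ = 1 := fun y => by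
    rw [← ofReal_norm, norm_chirp, ENNReal.ofReal_one]
  have h2 : ‖chirp (-α) x‖ₑ = 1 := by
    rw [← ofReal_norm, norm_chirp, ENNReal.ofReal_one]
  have h3 : ‖((|(Real.sin α)⁻¹| ^ n : ℝ) : ℂ)‖ₑ = ‖(Real.sin α)⁻¹‖ₑ ^ n := by
    rw [← ofReal_norm, ← ofReal_norm, Complex.norm_real, norm_pow,
      Real.norm_eq_abs, Real.norm_eq_abs, abs_abs, ENNReal.ofReal_pow (abs_nonneg _)]
  have h4 : ‖(Real.sin α)⁻¹‖ₑ ^ n ≠ ∞ := ENNReal.pow_ne_top enorm_ne_top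
  rw [fejerMean, fracConv, enorm_mul, enorm_mul, h2, h3, mul_one]
  calc _ ≤ ‖(Real.sin α)⁻¹‖ₑ ^ n * ∫⁻ y in fracCube n α,
        ‖chirp α y * f y * fejerKer n N fun i => (x i - y i) * (Real.sin α)⁻¹‖ₑ := by
        gcongr
        exact enorm_integral_le_lintegral_enorm _
    _ = _ := by
        rw [← lintegral_const_mul' _ _ h4]
        refine lintegral_congr fun y => ?_
        rw [enorm_mul, enorm_mul, h1]
        ring

theorem maximalFejer_le_boxMaximal {α : ℝ} (hα : Real.sin α ≠ 0) {f : (Fin n → ℝ) → ℂ}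
    (hf : StronglyMeasurable f) {x : Fin n → ℝ} (hx : x ∈ fracCube n α) :
    maximalFejer α f x ≤ boxMaximal |Real.sin α| (periodized α f) x := by
  refine iSup_mono fun N => (enorm_fejerMean_le α f N x).trans ?_
  set r := |Real.sin α| / (N + 1) with hr
  set g : (Fin n → ℝ) → ℝ≥0∞ := (fracCube n α).indicator fun z => ‖f z‖ₑ with hg
  have hgm : Measurable g := measurable_indicator_enorm α hf
  set v : (Fin n → ℤ) → Fin n → ℝ := fun l j => |Real.sin α| * (l j : ℝ) with hv
  have hi : ∀ k (l : Fin n → ℤ), Measurable fun y =>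
      (dyadicBox r k x).indicator (1 : (Fin n → ℝ) → ℝ≥0∞) (y + v l) := fun k l =>
    (measurable_one.indicator (measurableSet_dyadicBox r k x)).comp (measurable_id.add_const _)
  have hshift : ∀ k (l : Fin n → ℤ),
      ∫⁻ y, g y * (dyadicBox r k x).indicator 1 (y + v l)
        = ∫⁻ y in dyadicBox r k x, g (y - v l) := by
    intro k l
    rw [← lintegral_indicator (measurableSet_dyadicBox r k x),
      ← lintegral_add_right_eq_self (Set.indicator _ _) (v l)]
    refine lintegral_congr fun y => ?_
    by_cases h : y + v l ∈ dyadicBox r k x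
    · rw [Set.indicator_of_mem h, Set.indicator_of_mem h]
      simp
    · rw [Set.indicator_of_notMem h, Set.indicator_of_notMem h, mul_zero]
  calc ∫⁻ y in fracCube n α, ‖f y‖ₑ *
      (‖(Real.sin α)⁻¹‖ₑ ^ n * ‖fejerKer n N fun i => (x i - y i) * (Real.sin α)⁻¹‖ₑ)
      ≤ ∫⁻ y in fracCube n α, ‖f y‖ₑ * ∑ l ∈ neighbours n, ∑' k : Fin n → ℕ,
          boxWeight k * (volume (dyadicBox r k x))⁻¹ *
            (dyadicBox r k x).indicator 1 (y + v l) := by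
        refine setLIntegral_mono' (measurableSet_fracCube n α) fun y hy => ?_
        gcongr
        exact enorm_fejerKer_le hα N hx hy
    _ = ∫⁻ y, ∑ l ∈ neighbours n, ∑' k : Fin n → ℕ,
          boxWeight k * (volume (dyadicBox r k x))⁻¹ *
            (g y * (dyadicBox r k x).indicator 1 (y + v l)) := by
        rw [← lintegral_indicator (measurableSet_fracCube n α)]
        refine lintegral_congr fun y => ?_
        by_cases hy : y ∈ fracCube n α
        · rw [Set.indicator_of_mem hy, hg, Set.indicator_of_mem hy, Finset.mul_sum]
          refine Finset.sum_congr rfl fun l _ => ?_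
          rw [← ENNReal.tsum_mul_left]
          exact tsum_congr fun k => by ring
        · rw [Set.indicator_of_notMem hy, hg, Set.indicator_of_notMem hy]
          simp
    _ = ∑ l ∈ neighbours n, ∑' k : Fin n → ℕ,
          boxWeight k * (volume (dyadicBox r k x))⁻¹ *
            ∫⁻ y, g y * (dyadicBox r k x).indicator 1 (y + v l) := by
        have hm : ∀ k (l : Fin n → ℤ), Measurable fun y =>
            g y * (dyadicBox r k x).indicator (1 : (Fin n → ℝ) → ℝ≥0∞) (y + v l) :=
          fun k l => hgm.mul (hi k l)
        rw [lintegral_finsetSum _ fun l _ => Measurable.tsum fun k =>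
          (hm k l).const_mul _]
        refine Finset.sum_congr rfl fun l _ => ?_
        rw [lintegral_tsum fun k => ((hm k l).const_mul _).aemeasurable]
        exact tsum_congr fun k => lintegral_const_mul _ (hm k l)
    _ = ∑' k : Fin n → ℕ, boxWeight k * ((volume (dyadicBox r k x))⁻¹ *
          ∫⁻ y in dyadicBox r k x, periodized α f y) := by
        rw [← Summable.tsum_finsetSum fun _ _ => ENNReal.summable]
        refine tsum_congr fun k => ?_
        simp only [hshift, periodized]
        rw [← Finset.mul_sum, ← lintegral_finsetSum, mul_assoc]
        exact fun l _ => hgm.comp (measurable_id.sub_const _)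

end

/-! ### Bounds for the maximal Fejér operator -/

section
variable {n : ℕ}

theorem fejerMean_congr_ae {α : ℝ} {f f' : (Fin n → ℝ) → ℂ} (h : f =ᵐ[torusMeasure n α] f')
    (N : ℕ) (x : Fin n → ℝ) : fejerMean α N f x = fejerMean α N f' x := by
  unfold fejerMean fracConv
  congr 1
  refine integral_congr_ae ?_
  filter_upwards [h] with y hy
  rw [hy]

theorem maximalFejer_congr_ae {α : ℝ} {f f' : (Fin n → ℝ) → ℂ} (h : f =ᵐ[torusMeasure n α] f') :
    maximalFejer α f = maximalFejer α f' := by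
  ext x
  simp only [maximalFejer, fejerMean_congr_ae h]

theorem integrable_fejer_integrand {α : ℝ} {f : (Fin n → ℝ) → ℂ}
    (hf : Integrable f (torusMeasure n α)) (N : ℕ) (x : Fin n → ℝ) :
    Integrable (fun y => chirp α y * f y * fejerKer n N fun i => (x i - y i) * (Real.sin α)⁻¹)
      (torusMeasure n α) := by
  refine Integrable.mul_bdd (c := (N + 1) ^ n) (Integrable.bdd_mul (c := 1) hf ?_ ?_) ?_ ?_
  · exact (continuous_chirp α).aestronglyMeasurable
  · exact Eventually.of_forall fun y => (norm_chirp α y).le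
  · exact Continuous.aestronglyMeasurable (by fun_prop)
  · exact Eventually.of_forall fun y => norm_fejerKer_le n N _

theorem continuous_fejerMean {α : ℝ} {f : (Fin n → ℝ) → ℂ}
    (hf : Integrable f (torusMeasure n α)) (N : ℕ) : Continuous (fejerMean α N f) := by
  unfold fejerMean fracConv
  refine (continuous_const.mul (continuous_chirp _)).mul ?_
  refine continuous_of_dominated (bound := fun y => ‖f y‖ * (N + 1) ^ n)
    (fun x => (integrable_fejer_integrand hf N x).aestronglyMeasurable)
    (fun x => Eventually.of_forall fun y => ?_) (hf.norm.mul_const _)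
    (Eventually.of_forall fun y => by fun_prop)
  rw [norm_mul, norm_mul, norm_chirp, one_mul]
  gcongr
  exact norm_fejerKer_le n N _

theorem measurable_maximalFejer {α : ℝ} {f : (Fin n → ℝ) → ℂ}
    (hf : Integrable f (torusMeasure n α)) : Measurable (maximalFejer α f) :=
  Measurable.iSup fun N => (continuous_fejerMean hf N).measurable.enorm

/-- The chirp factor is not periodic, but it has modulus one, so that `|f ∗_α F_N|` is. -/
theorem isTorusFun_maximalFejer {α : ℝ} (hα : Real.sin α ≠ 0) (f : (Fin n → ℝ) → ℂ) :
    IsTorusFun α (maximalFejer α f) := by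
  intro m x
  refine iSup_congr fun N => ?_
  have hker : ∀ y : Fin n → ℝ,
      fejerKer n N (fun i => (x i + |Real.sin α| * m i - y i) * (Real.sin α)⁻¹)
        = fejerKer n N (fun i => (x i - y i) * (Real.sin α)⁻¹) := by
    intro y
    refine Finset.prod_congr rfl fun j _ => ?_
    obtain ⟨l, hl⟩ : ∃ l : ℤ, |Real.sin α| * m j * (Real.sin α)⁻¹ = l := by
      rcases abs_cases (Real.sin α) with ⟨h, _⟩ | ⟨h, _⟩ <;> rw [h]
      · exact ⟨m j, by field_simp⟩
      · exact ⟨-m j, by push_cast; field_simp⟩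
    rw [← fejerKer1_add_intCast N ((x j - y j) * (Real.sin α)⁻¹) l, ← hl]
    congr 1
    ring
  have h1 : ∀ z : Fin n → ℝ, ‖chirp (-α) z‖ₑ = 1 := fun z => by
    rw [← ofReal_norm, norm_chirp, ENNReal.ofReal_one]
  simp only [fejerMean, fracConv, hker, enorm_mul, h1]

theorem exists_mul_meas_maximalFejer_le (n : ℕ) : ∃ C : ℝ≥0, ∀ α : ℝ, Real.sin α ≠ 0 →
    ∀ f : (Fin n → ℝ) → ℂ, AEStronglyMeasurable f (torusMeasure n α) → ∀ t : ℝ≥0∞,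
      t * torusMeasure n α {x | t < maximalFejer α f x}
        ≤ C * eLpNorm f 1 (torusMeasure n α) := by
  obtain ⟨C, hC⟩ := exists_mul_volume_boxMaximal_le n
  refine ⟨C * (neighbours n).card, fun α hα f hf t => ?_⟩
  rw [maximalFejer_congr_ae hf.ae_eq_mk, eLpNorm_congr_ae hf.ae_eq_mk]
  set g := hf.mk f
  have hg : StronglyMeasurable g := hf.stronglyMeasurable_mk
  have hH := eLpNorm_periodized_le α hg le_rfl
  rw [eLpNorm_one_eq_lintegral_enorm] at hH
  simp only [enorm_eq_self] at hH
  calc t * torusMeasure n α {x | t < maximalFejer α g x}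
      ≤ t * volume {x | t < boxMaximal |Real.sin α| (periodized α g) x} := by
        gcongr t * ?_
        rw [torusMeasure, Measure.restrict_apply' (measurableSet_fracCube n α)]
        refine measure_mono fun x hx => ?_
        exact lt_of_lt_of_le hx.1 (maximalFejer_le_boxMaximal hα hg hx.2)
    _ ≤ C * ∫⁻ y, periodized α g y := hC _ (abs_pos.2 hα) _ _
    _ ≤ C * ((neighbours n).card * eLpNorm g 1 (torusMeasure n α)) := by gcongr
    _ = _ := by push_cast; ring

theorem maximalFejer_lt_top_ae {α : ℝ} (hα : Real.sin α ≠ 0) {f : (Fin n → ℝ) → ℂ}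
    (hf : Integrable f (torusMeasure n α)) :
    ∀ᵐ x ∂torusMeasure n α, maximalFejer α f x < ∞ := by
  obtain ⟨C, hC⟩ := exists_mul_meas_maximalFejer_le n
  have hfin : (C : ℝ≥0∞) * eLpNorm f 1 (torusMeasure n α) ≠ ∞ :=
    ENNReal.mul_ne_top ENNReal.coe_ne_top (memLp_one_iff_integrable.2 hf).eLpNorm_ne_top
  rw [ae_iff]
  by_contra hne
  obtain ⟨m, hm⟩ := ENNReal.exists_nat_mul_gt hne hfin
  refine hm.not_ge (le_trans ?_ (hC α hα f hf.aestronglyMeasurable m))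
  gcongr with x
  intro hx
  rw [not_lt, top_le_iff] at hx
  rw [hx]
  exact ENNReal.natCast_lt_top m

theorem exists_eLpNorm_top_maximalFejer_le (n : ℕ) : ∃ C : ℝ≥0, ∀ α : ℝ, Real.sin α ≠ 0 →
    ∀ f : (Fin n → ℝ) → ℂ, AEStronglyMeasurable f (torusMeasure n α) →
      eLpNorm (maximalFejer α f) ∞ (torusMeasure n α)
        ≤ C * eLpNorm f ∞ (torusMeasure n α) := by
  have hW := tsum_boxWeight_ne_top n
  refine ⟨(∑' k : Fin n → ℕ, boxWeight k).toNNReal * (neighbours n).card, fun α hα f hf => ?_⟩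
  rw [maximalFejer_congr_ae hf.ae_eq_mk, eLpNorm_congr_ae hf.ae_eq_mk]
  set g := hf.mk f
  have hg : StronglyMeasurable g := hf.stronglyMeasurable_mk
  have hH := eLpNorm_periodized_le α hg le_top
  rw [ENNReal.coe_mul, ENNReal.coe_toNNReal hW, eLpNorm_exponent_top]
  refine eLpNormEssSup_le_of_ae_enorm_bound ?_
  rw [torusMeasure, ae_restrict_iff' (measurableSet_fracCube n α)]
  refine Eventually.of_forall fun x hx => ?_
  rw [enorm_eq_self]
  refine (maximalFejer_le_boxMaximal hα hg hx).trans ?_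
  refine (boxMaximal_le_of_ae_le _ (t := eLpNorm (periodized α g) ∞ volume) ?_ x).trans ?_
  · rw [eLpNorm_exponent_top]
    simpa only [enorm_eq_self] using enorm_ae_le_eLpNormEssSup (periodized α g) volume
  · rw [mul_assoc]
    gcongr
    exact hH

theorem exists_eLpNorm_maximalFejer_le (n : ℕ) {p : ℝ≥0∞} (hp : 1 < p) (hp' : p ≠ ∞) :
    ∃ C : ℝ≥0, ∀ α : ℝ, Real.sin α ≠ 0 →
    ∀ f : (Fin n → ℝ) → ℂ, Integrable f (torusMeasure n α) →
      eLpNorm (maximalFejer α f) p (torusMeasure n α)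
        ≤ C * eLpNorm f p (torusMeasure n α) := by
  obtain ⟨A, C, hC⟩ := exists_mul_volume_boxMaximal_le_setLIntegral n
  set q := p.toReal with hq
  have hq1 : 1 < q := by
    rw [hq, ← ENNReal.toReal_one]
    exact (ENNReal.toReal_lt_toReal ENNReal.one_ne_top hp').2 hp
  have hq0 : 0 < q := by linarith
  have hp0 : p ≠ 0 := (zero_lt_one.trans hp).ne'
  set K : ℝ≥0∞ := C * ENNReal.ofReal (q / (q - 1)) with hK
  have hKtop : K ^ (1 / q) ≠ ∞ := by
    have : K ≠ ∞ := ENNReal.mul_ne_top ENNReal.coe_ne_top ENNReal.ofReal_ne_top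
    exact ENNReal.rpow_ne_top_of_nonneg (by positivity) this
  refine ⟨(K ^ (1 / q)).toNNReal * (A * (neighbours n).card), fun α hα f hf => ?_⟩
  have hGm := measurable_maximalFejer hf
  have hGtop := maximalFejer_lt_top_ae hα hf
  have hfm := hf.aestronglyMeasurable
  rw [eLpNorm_congr_ae hfm.ae_eq_mk]
  rw [maximalFejer_congr_ae hfm.ae_eq_mk] at hGm hGtop ⊢
  set g := hfm.mk f
  have hg : StronglyMeasurable g := hfm.stronglyMeasurable_mk
  set H := periodized α g with hHdef
  have hHm : Measurable H := measurable_periodized α hg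
  have hHof : ∀ y, ENNReal.ofReal (A * (H y).toReal) = A * H y := fun y => by
    rw [ENNReal.ofReal_mul A.coe_nonneg, ENNReal.ofReal_coe_nnreal,
      ENNReal.ofReal_toReal (periodized_lt_top α g y).ne]
  have hw := lintegral_rpow_le_of_weak_type (μ := torusMeasure n α)
    (ν := (volume : Measure (Fin n → ℝ))) (G := maximalFejer α g)
    (f := fun y => A * (H y).toReal) hGm.aemeasurable hGtop (by fun_prop)
    (fun y => by positivity) (C := C) ENNReal.coe_ne_top (fun t ht => by
      have h1 : ∀ y, t < A * (H y).toReal ↔ ENNReal.ofReal t < A * H y := fun y => by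
        rw [← hHof, ENNReal.ofReal_lt_ofReal_iff_of_nonneg ht.le]
      simp only [hHof, h1]
      refine le_trans ?_ (hC _ (abs_pos.2 hα) H (ENNReal.ofReal t))
      gcongr _ * ?_
      rw [torusMeasure, Measure.restrict_apply' (measurableSet_fracCube n α)]
      refine measure_mono fun x hx => ?_
      exact lt_of_lt_of_le hx.1 (maximalFejer_le_boxMaximal hα hg hx.2)) hq1
  simp only [hHof] at hw
  have hHn := eLpNorm_periodized_le α hg hp.le
  rw [eLpNorm_eq_lintegral_rpow_enorm_toReal hp0 hp'] at hHn ⊢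
  simp only [enorm_eq_self, ← hq] at hHn ⊢
  calc (∫⁻ x, maximalFejer α g x ^ q ∂torusMeasure n α) ^ (1 / q)
      ≤ (K * ∫⁻ y, (A * H y) ^ q) ^ (1 / q) := by gcongr
    _ = K ^ (1 / q) * (A * (∫⁻ y, H y ^ q) ^ (1 / q)) := by
        simp_rw [ENNReal.mul_rpow_of_nonneg _ _ hq0.le]
        rw [lintegral_const_mul _ (by fun_prop), ENNReal.mul_rpow_of_nonneg K _ (by positivity),
          ENNReal.mul_rpow_of_nonneg (A ^ q) _ (by positivity), ← ENNReal.rpow_mul,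
          mul_one_div_cancel hq0.ne', ENNReal.rpow_one]
    _ ≤ K ^ (1 / q) * (A * ((neighbours n).card * eLpNorm g p (torusMeasure n α))) := by
        gcongr
    _ = _ := by
        rw [ENNReal.coe_mul, ENNReal.coe_toNNReal hKtop]
        push_cast
        ring

/-- On `e_{-α} L^p` measurability is inherited from the factor `g ∈ L^p`. -/
theorem MemFracLp.aestronglyMeasurable {α : ℝ} {p : ℝ≥0∞} {f : (Fin n → ℝ) → ℂ}
    (hf : MemFracLp α p f) : AEStronglyMeasurable f (torusMeasure n α) := by
  obtain ⟨⟨g, ⟨_, hg⟩, hfg⟩, _⟩ := hf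
  exact ((continuous_chirp _).aestronglyMeasurable.mul hg.1).congr hfg.symm

theorem MemFracLp.integrable {α : ℝ} {p : ℝ≥0∞} (hp : 1 ≤ p) {f : (Fin n → ℝ) → ℂ}
    (hf : MemFracLp α p f) : Integrable f (torusMeasure n α) :=
  MemLp.integrable hp ⟨hf.aestronglyMeasurable, hf.2⟩

theorem sin_ne_zero_of_ne_int_mul_pi {α : ℝ} (hα : ∀ k : ℤ, α ≠ k * Real.pi) :
    Real.sin α ≠ 0 := by
  rw [Real.sin_ne_zero_iff]
  exact fun k h => hα k h.symm

end

/-! ### Convergence for trigonometric polynomials and their density -/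

section
variable {n : ℕ}

theorem fejerMean_add {α : ℝ} {f g : (Fin n → ℝ) → ℂ} (hf : Integrable f (torusMeasure n α))
    (hg : Integrable g (torusMeasure n α)) (N : ℕ) (x : Fin n → ℝ) :
    fejerMean α N (f + g) x = fejerMean α N f x + fejerMean α N g x := by
  unfold fejerMean fracConv
  rw [← mul_add]
  congr 1
  refine Eq.trans ?_ (integral_add (integrable_fejer_integrand hf N x)
    (integrable_fejer_integrand hg N x))
  refine integral_congr_ae (Eventually.of_forall fun y => ?_)
  simp only [Pi.add_apply]
  ring

theorem fejerMean_smul (α : ℝ) (a : ℂ) (f : (Fin n → ℝ) → ℂ) (N : ℕ) (x : Fin n → ℝ) :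
    fejerMean α N (a • f) x = a * fejerMean α N f x := by
  unfold fejerMean fracConv
  rw [mul_left_comm]
  congr 1
  rw [← integral_const_mul]
  refine integral_congr_ae (Eventually.of_forall fun y => ?_)
  simp only [Pi.smul_apply, smul_eq_mul]
  ring

theorem integral_exp_two_pi_int_mul {c : ℝ} (hc : c ≠ 0) (m : ℤ) :
    ∫ y in Set.Icc (-(|c| / 2)) (|c| / 2), Complex.exp (2 * Real.pi * Complex.I * m * (y * c⁻¹))
      = if m = 0 then ((|c| : ℝ) : ℂ) else 0 := by
  have hc0 : 0 ≤ |c| := abs_nonneg c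
  have hcC : (c : ℂ) ≠ 0 := by exact_mod_cast hc
  rw [integral_Icc_eq_integral_Ioc, ← intervalIntegral.integral_of_le (by linarith)]
  split_ifs with hm
  · simp [hm]
  · have hk : (2 * Real.pi * Complex.I * m * (c : ℂ)⁻¹) ≠ 0 := by
      have := Complex.two_pi_I_ne_zero
      have hm' : (m : ℂ) ≠ 0 := by exact_mod_cast hm
      exact mul_ne_zero (mul_ne_zero this hm') (inv_ne_zero hcC)
    have h := integral_exp_mul_complex (a := -(|c| / 2)) (b := |c| / 2) hk
    have h1 : ∀ y : ℝ, (2 * Real.pi * Complex.I * m * (y * (c⁻¹ : ℝ)))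
        = 2 * Real.pi * Complex.I * m * (c : ℂ)⁻¹ * y := fun y => by
      push_cast; ring
    simp only [h1]
    rw [h, div_eq_zero_iff]
    left
    obtain ⟨l, hl⟩ : ∃ l : ℤ, (m : ℂ) * (c : ℂ)⁻¹ * (|c| : ℝ) = l := by
      rcases abs_cases c with ⟨h, _⟩ | ⟨h, _⟩ <;> rw [h]
      · exact ⟨m, by field_simp⟩
      · exact ⟨-m, by push_cast; field_simp⟩
    rw [sub_eq_zero, Complex.exp_eq_exp_iff_exists_int]
    refine ⟨l, ?_⟩
    rw [← hl]
    push_cast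
    ring

theorem integral_fourier_mul_dirichletKer {c : ℝ} (hc : c ≠ 0) (m : ℤ) (k : ℕ) (x : ℝ) :
    ∫ y in Set.Icc (-(|c| / 2)) (|c| / 2),
        Complex.exp (2 * Real.pi * Complex.I * m * (y * c⁻¹)) * dirichletKer k ((x - y) * c⁻¹)
      = if m.natAbs ≤ k then
          ((|c| : ℝ) : ℂ) * Complex.exp (2 * Real.pi * Complex.I * m * (x * c⁻¹)) else 0 := by
  have h1 : ∀ y : ℝ, Complex.exp (2 * Real.pi * Complex.I * m * (y * c⁻¹)) *
      dirichletKer k ((x - y) * c⁻¹) = ∑ l ∈ Finset.Icc (-(k : ℤ)) k,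
        Complex.exp (2 * Real.pi * Complex.I * l * (x * c⁻¹)) *
          Complex.exp (2 * Real.pi * Complex.I * ((m - l : ℤ) : ℂ) * (y * c⁻¹)) := by
    intro y
    rw [dirichletKer, Finset.mul_sum]
    refine Finset.sum_congr rfl fun l _ => ?_
    rw [← Complex.exp_add, ← Complex.exp_add]
    congr 1
    push_cast
    ring
  simp only [h1]
  rw [integral_finsetSum _ fun l _ => Continuous.integrableOn_Icc (by fun_prop)]
  simp only [integral_const_mul, integral_exp_two_pi_int_mul hc, sub_eq_zero, mul_ite, mul_zero,
    Finset.sum_ite_eq, Finset.mem_Icc]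
  have : (-(k : ℤ) ≤ m ∧ m ≤ k) ↔ m.natAbs ≤ k := by omega
  simp only [this]
  split_ifs
  · ring
  · rfl

@[fun_prop]
theorem continuous_dirichletKer (k : ℕ) : Continuous (dirichletKer k) := by
  unfold dirichletKer
  fun_prop

/-- The Fejér means of a character are Cesàro means of a sequence which is eventually equal to that
character. -/
theorem tendsto_integral_fourier_mul_fejerKer1 {c : ℝ} (hc : c ≠ 0) (m : ℤ) (x : ℝ) :
    Tendsto (fun N : ℕ => ((|c⁻¹| : ℝ) : ℂ) * ∫ y in Set.Icc (-(|c| / 2)) (|c| / 2),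
        Complex.exp (2 * Real.pi * Complex.I * m * (y * c⁻¹)) * fejerKer1 N ((x - y) * c⁻¹))
      atTop (𝓝 (Complex.exp (2 * Real.pi * Complex.I * m * (x * c⁻¹)))) := by
  set e := Complex.exp (2 * Real.pi * Complex.I * m * (x * c⁻¹)) with he
  have hu : Tendsto (fun k : ℕ => if m.natAbs ≤ k then e else 0) atTop (𝓝 e) :=
    tendsto_const_nhds.congr' ((eventually_ge_atTop m.natAbs).mono fun k hk => (if_pos hk).symm)
  refine (hu.cesaro_smul.comp (tendsto_add_atTop_nat 1)).congr fun N => ?_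
  have hcC : ((|c| : ℝ) : ℂ) ≠ 0 := by exact_mod_cast (abs_pos.2 hc).ne'
  have h1 : ∀ y : ℝ, Complex.exp (2 * Real.pi * Complex.I * m * (y * c⁻¹)) *
      fejerKer1 N ((x - y) * c⁻¹) = 1 / ((N : ℂ) + 1) * ∑ k ∈ Finset.range (N + 1),
        Complex.exp (2 * Real.pi * Complex.I * m * (y * c⁻¹)) *
          dirichletKer k ((x - y) * c⁻¹) := by
    intro y
    rw [fejerKer1, ← Finset.mul_sum]
    ring
  simp only [h1, Function.comp_apply]
  rw [integral_const_mul, integral_finsetSum _ fun k _ =>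
    Continuous.integrableOn_Icc (by fun_prop)]
  simp only [integral_fourier_mul_dirichletKer hc, ← he]
  rw [abs_inv, Complex.real_smul, Finset.mul_sum, Finset.mul_sum, Finset.mul_sum]
  refine Finset.sum_congr rfl fun k _ => ?_
  split_ifs
  · push_cast
    field_simp
  · simp

/-- The covering map from `ℝⁿ` to the standard torus, scaled to have period `c`. -/
noncomputable def toUnitTorus (c : ℝ) (y : Fin n → ℝ) : UnitAddTorus (Fin n) := fun j => ((y j * c⁻¹ : ℝ) : _)

@[fun_prop]
theorem continuous_toUnitTorus (c : ℝ) :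
    Continuous (toUnitTorus c : (Fin n → ℝ) → UnitAddTorus (Fin n)) :=
  continuous_pi fun j => (AddCircle.continuous_mk' 1).comp (by fun_prop)

theorem mFourier_toUnitTorus (c : ℝ) (m : Fin n → ℤ) (y : Fin n → ℝ) :
    UnitAddTorus.mFourier m (toUnitTorus c y)
      = ∏ j, Complex.exp (2 * Real.pi * Complex.I * m j * (y j * c⁻¹)) := by
  rw [UnitAddTorus.mFourier, ContinuousMap.coe_mk]
  refine Finset.prod_congr rfl fun j _ => ?_
  rw [toUnitTorus, fourier_coe_apply]
  congr 1
  push_cast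
  ring

theorem torusMeasure_eq_pi (n : ℕ) (α : ℝ) : torusMeasure n α = Measure.pi fun _ : Fin n =>
    volume.restrict (Set.Icc (-(|Real.sin α| / 2)) (|Real.sin α| / 2)) := by
  rw [torusMeasure, fracCube, ← Set.pi_univ_Icc, volume_pi, Measure.restrict_pi_pi]

theorem tendsto_fejerMean_mFourier {α : ℝ} (hα : Real.sin α ≠ 0) (m : Fin n → ℤ)
    (x : Fin n → ℝ) :
    Tendsto (fun N => fejerMean α N (fun y => chirp (-α) y *
        UnitAddTorus.mFourier m (toUnitTorus (Real.sin α) y)) x) atTop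
      (𝓝 (chirp (-α) x * UnitAddTorus.mFourier m (toUnitTorus (Real.sin α) x))) := by
  have h : ∀ N, fejerMean α N (fun y => chirp (-α) y *
        ∏ j, Complex.exp (2 * Real.pi * Complex.I * m j * (y j * (Real.sin α)⁻¹))) x
      = chirp (-α) x * ∏ j, (((|(Real.sin α)⁻¹| : ℝ) : ℂ) *
          ∫ y in Set.Icc (-(|Real.sin α| / 2)) (|Real.sin α| / 2),
            Complex.exp (2 * Real.pi * Complex.I * m j * (y * ((Real.sin α)⁻¹ : ℝ))) *
              fejerKer1 N ((x j - y) * (Real.sin α)⁻¹)) := by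
    intro N
    rw [fejerMean, fracConv, Finset.prod_mul_distrib, ← integral_fintype_prod_eq_prod,
      ← torusMeasure_eq_pi, Finset.prod_const, Finset.card_univ, Fintype.card_fin, ← mul_assoc,
      torusMeasure]
    congr 1
    · push_cast; ring
    · refine integral_congr_ae (Eventually.of_forall fun y => ?_)
      simp only [fejerKer]
      rw [← mul_assoc, chirp_mul_chirp_neg, one_mul, ← Finset.prod_mul_distrib]
  simp only [mFourier_toUnitTorus, h]
  exact tendsto_const_nhds.mul (tendsto_finsetProd _ fun j _ =>
    tendsto_integral_fourier_mul_fejerKer1 hα (m j) (x j))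

theorem integrable_chirp_mul {α : ℝ} (P : C(UnitAddTorus (Fin n), ℂ)) :
    Integrable (fun y => chirp (-α) y * P (toUnitTorus (Real.sin α) y)) (torusMeasure n α) :=
  Continuous.integrableOn_Icc (by fun_prop)

theorem tendsto_fejerMean_of_mem_span {α : ℝ} (hα : Real.sin α ≠ 0)
    {P : C(UnitAddTorus (Fin n), ℂ)}
    (hP : P ∈ Submodule.span ℂ (Set.range (UnitAddTorus.mFourier (d := Fin n))))
    (x : Fin n → ℝ) :
    Tendsto (fun N => fejerMean α N (fun y => chirp (-α) y * P (toUnitTorus (Real.sin α) y)) x)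
      atTop (𝓝 (chirp (-α) x * P (toUnitTorus (Real.sin α) x))) := by
  induction hP using Submodule.span_induction with
  | mem P hP =>
    obtain ⟨m, rfl⟩ := hP
    exact tendsto_fejerMean_mFourier hα m x
  | zero =>
    simp [fejerMean, fracConv]
  | add P Q _ _ hP hQ =>
    have h := hP.add hQ
    rw [← mul_add] at h
    refine h.congr fun N => ?_
    rw [← fejerMean_add (integrable_chirp_mul P) (integrable_chirp_mul Q)]
    congr 1
    ext y
    simp only [Pi.add_apply, ContinuousMap.add_apply]
    ring
  | smul a P _ hP =>
    have h := hP.const_mul a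
    rw [ContinuousMap.smul_apply, smul_eq_mul, mul_left_comm]
    refine h.congr fun N => ?_
    rw [← fejerMean_smul]
    congr 1
    ext y
    simp only [Pi.smul_apply, ContinuousMap.smul_apply, smul_eq_mul]
    ring

/-- The Haar probability measure of `UnitAddTorus (Fin n)`. -/
noncomputable def unitTorusMeasure (n : ℕ) : Measure (UnitAddTorus (Fin n)) :=
  Measure.pi fun _ => AddCircle.haarAddCircle

instance (n : ℕ) : IsProbabilityMeasure (unitTorusMeasure n) :=
  inferInstanceAs (IsProbabilityMeasure (Measure.pi fun _ => AddCircle.haarAddCircle))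

/-- The section of `toUnitTorus` with values in the cube of side `|c|`. -/
noncomputable def ofUnitTorus (c : ℝ) (t : UnitAddTorus (Fin n)) : Fin n → ℝ :=
  c • (UnitAddTorus.measurableEquivPiIoc (fun _ : Fin n => -(1 / 2 : ℝ)) t).1

theorem toUnitTorus_ofUnitTorus {c : ℝ} (hc : c ≠ 0) (t : UnitAddTorus (Fin n)) :
    toUnitTorus c (ofUnitTorus c t) = t := by
  ext j
  have h : c * (AddCircle.equivIoc (1 : ℝ) (-(1 / 2)) (t j)).1 * c⁻¹
      = (AddCircle.equivIoc (1 : ℝ) (-(1 / 2)) (t j)).1 := by field_simp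
  simp only [toUnitTorus, ofUnitTorus, UnitAddTorus.coe_measurableEquivPiIoc_apply, Pi.smul_apply,
    smul_eq_mul]
  rw [h]
  exact (AddCircle.equivIoc (1 : ℝ) (-(1 / 2))).symm_apply_apply (t j)

theorem measurable_ofUnitTorus (c : ℝ) :
    Measurable (ofUnitTorus c : UnitAddTorus (Fin n) → Fin n → ℝ) :=
  (measurable_subtype_coe.comp (MeasurableEquiv.measurable _)).const_smul c

/-- The section carries Haar measure to normalized Lebesgue measure on the cube; the boundary of the
cube, on which the section misses points, is a null set. -/
theorem map_ofUnitTorus {α : ℝ} (hα : Real.sin α ≠ 0) :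
    Measure.map (ofUnitTorus (Real.sin α)) (unitTorusMeasure n)
      = ENNReal.ofReal |(Real.sin α ^ n)⁻¹| • torusMeasure n α := by
  set c := Real.sin α with hc
  set S : Set (Fin n → ℝ) := {x | ∀ i, x i ∈ Set.Ioc (-(1 / 2 : ℝ)) (-(1 / 2) + 1)} with hS
  have hSm : MeasurableSet S := MeasurableSet.univ_pi' fun i => measurableSet_Ioc
  have h1 : Measure.map (fun t : UnitAddTorus (Fin n) =>
      (UnitAddTorus.measurableEquivPiIoc (fun _ : Fin n => -(1 / 2 : ℝ)) t).1) (unitTorusMeasure n)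
        = volume.restrict S := by
    have h : Measure.map (UnitAddTorus.measurableEquivPiIoc fun _ : Fin n => -(1 / 2 : ℝ))
        (unitTorusMeasure n) = Measure.comap Subtype.val volume :=
      (UnitAddTorus.measurePreserving_equivPiIoc (fun _ : Fin n => -(1 / 2 : ℝ))).map_eq
    refine Eq.trans ?_ ((congrArg (Measure.map Subtype.val) h).trans
      (map_comap_subtype_coe hSm (volume : Measure (Fin n → ℝ))))
    rw [Measure.map_map measurable_subtype_coe (MeasurableEquiv.measurable _)]
    rfl
  have h2 : S =ᵐ[volume] (c • · : (Fin n → ℝ) → Fin n → ℝ) ⁻¹' fracCube n α := by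
    have hS' : S = Set.pi Set.univ fun _ => Set.Ioc (-(1 / 2 : ℝ)) (-(1 / 2) + 1) := by
      ext x; simp [hS]
    have hQ : (c • · : (Fin n → ℝ) → Fin n → ℝ) ⁻¹' fracCube n α
        = Set.Icc (fun _ => -(1 / 2 : ℝ)) (fun _ => -(1 / 2) + 1) := by
      ext x
      simp only [fracCube, Set.mem_preimage, Set.mem_Icc, Pi.le_def, Pi.smul_apply, smul_eq_mul,
        ← forall_and, ← hc]
      refine forall_congr' fun j => ?_
      have hpos : 0 < |c| := abs_pos.2 hα
      rw [← abs_le, abs_mul, show (-(1 / 2) + 1 : ℝ) = 1 / 2 by norm_num, ← abs_le,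
        div_eq_mul_one_div |c|, mul_le_mul_iff_right₀ hpos]
    rw [hS', hQ]
    exact Measure.univ_pi_Ioc_ae_eq_Icc
  have h3 : (ofUnitTorus c : UnitAddTorus (Fin n) → Fin n → ℝ) = (c • ·) ∘ fun t =>
      (UnitAddTorus.measurableEquivPiIoc (fun _ : Fin n => -(1 / 2 : ℝ)) t).1 := rfl
  rw [h3, ← Measure.map_map (g := fun x : Fin n → ℝ => c • x)
    (f := fun t : UnitAddTorus (Fin n) =>
      (UnitAddTorus.measurableEquivPiIoc (fun _ : Fin n => -(1 / 2 : ℝ)) t).1)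
    (measurable_const_smul c)
    (measurable_subtype_coe.comp (MeasurableEquiv.measurable _)), h1,
    Measure.restrict_congr_set h2, ← Measure.restrict_map (measurable_const_smul c)
      (measurableSet_fracCube n α), Measure.map_addHaar_smul _ hα, Measure.restrict_smul,
    Module.finrank_fin_fun, torusMeasure]

/-- Density of the trigonometric polynomials in `L¹` of the cube. -/
theorem exists_mem_span_eLpNorm_sub_le {α : ℝ} (hα : Real.sin α ≠ 0) {g : (Fin n → ℝ) → ℂ}
    (hg : Integrable g (torusMeasure n α)) {δ : ℝ≥0∞} (hδ : δ ≠ 0) :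
    ∃ P ∈ Submodule.span ℂ (Set.range (UnitAddTorus.mFourier (d := Fin n))),
      eLpNorm (fun y => g y - P (toUnitTorus (Real.sin α) y)) 1 (torusMeasure n α) ≤ δ := by
  set c := Real.sin α with hc
  set K := ENNReal.ofReal |(c ^ n)⁻¹| with hK
  have hK0 : K ≠ 0 := by
    rw [hK, ne_eq, ENNReal.ofReal_eq_zero, not_le]
    positivity
  have hKt : K ≠ ∞ := ENNReal.ofReal_ne_top
  have hmap := map_ofUnitTorus (n := n) hα
  rw [← hc, ← hK] at hmap
  have hρ := measurable_ofUnitTorus (n := n) c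
  have hgK : MemLp g 1 (K • torusMeasure n α) :=
    (memLp_one_iff_integrable.2 hg).smul_measure hKt
  have hgρ : MemLp (g ∘ ofUnitTorus c) 1 (unitTorusMeasure n) := by
    rw [← hmap] at hgK
    exact (memLp_map_measure_iff hgK.1 hρ.aemeasurable).1 hgK
  obtain ⟨η, hη0, hη⟩ : ∃ η : ℝ, 0 < η ∧ ENNReal.ofReal η ≤ K * δ / 2 := by
    have h0 : K * δ / 2 ≠ 0 := by simp [hK0, hδ]
    obtain ⟨η, h1, h2⟩ := ENNReal.lt_iff_exists_nnreal_btwn.1 (pos_iff_ne_zero.2 h0)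
    exact ⟨η, by exact_mod_cast h1, by rw [ENNReal.ofReal_coe_nnreal]; exact h2.le⟩
  obtain ⟨F, hF, -⟩ := hgρ.exists_boundedContinuous_eLpNorm_sub_le ENNReal.one_ne_top
    (ε := ENNReal.ofReal η) (by simpa using hη0)
  have hFmem : F.toContinuousMap ∈ closure
      (Submodule.span ℂ (Set.range (UnitAddTorus.mFourier (d := Fin n))) :
        Set C(UnitAddTorus (Fin n), ℂ)) := by
    rw [← Submodule.topologicalClosure_coe, UnitAddTorus.span_mFourier_closure_eq_top]
    trivial
  obtain ⟨P, hP, hFP⟩ := Metric.mem_closure_iff.1 hFmem η hη0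
  refine ⟨P, hP, ?_⟩
  have hFP' : eLpNorm (fun t => F t - P t) 1 (unitTorusMeasure n)
      ≤ ENNReal.ofReal η := by
    refine (eLpNorm_le_of_ae_bound (C := η) (Eventually.of_forall fun t => ?_)).trans ?_
    · rw [← dist_eq_norm]
      exact (ContinuousMap.dist_apply_le_dist (f := F.toContinuousMap) (g := P) t).trans hFP.le
    · simp
  have h1 : eLpNorm (fun t => g (ofUnitTorus c t) - P t) 1
      (unitTorusMeasure n) ≤ K * δ := by
    have : (fun t => g (ofUnitTorus c t) - P t)
        = (g ∘ ofUnitTorus c - F) + fun t => F t - P t := by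
      ext t
      simp
    rw [this]
    refine (eLpNorm_add_le (hgρ.1.sub F.continuous.aestronglyMeasurable)
      (Continuous.aestronglyMeasurable (by fun_prop)) le_rfl).trans ?_
    calc _ ≤ K * δ / 2 + K * δ / 2 := add_le_add (hF.trans hη) (hFP'.trans hη)
      _ = K * δ := ENNReal.add_halves _
  have hm : AEStronglyMeasurable (fun y => g y - P (toUnitTorus c y))
      (Measure.map (ofUnitTorus c) (unitTorusMeasure n)) := by
    rw [hmap]
    exact hgK.1.sub (Continuous.aestronglyMeasurable (by fun_prop))
  have h2 := eLpNorm_map_measure (p := 1) hm hρ.aemeasurable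
  have h3 : (fun y => g y - P (toUnitTorus c y)) ∘ ofUnitTorus c
      = fun t => g (ofUnitTorus c t) - P t := by
    ext t
    simp only [Function.comp_apply, toUnitTorus_ofUnitTorus hα]
  rw [h3, hmap, eLpNorm_one_eq_lintegral_enorm, lintegral_smul_measure,
    ← eLpNorm_one_eq_lintegral_enorm, smul_eq_mul] at h2
  rw [← h2] at h1
  exact (ENNReal.mul_le_mul_iff_right hK0 hKt).1 h1

/-! ### Convergence almost everywhere -/

theorem fejerMean_sub {α : ℝ} {f g : (Fin n → ℝ) → ℂ} (hf : Integrable f (torusMeasure n α))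
    (hg : Integrable g (torusMeasure n α)) (N : ℕ) (x : Fin n → ℝ) :
    fejerMean α N (f - g) x = fejerMean α N f x - fejerMean α N g x := by
  have h := fejerMean_add (hf.sub hg) hg N x
  rw [sub_add_cancel] at h
  rw [h, add_sub_cancel_right]

/-- For each `ε` the Fejér means are almost everywhere eventually `ε`-close to `f`: approximate `f`
by a chirp times a trigonometric polynomial, and control the error by the maximal function. -/
theorem ae_eventually_norm_fejerMean_sub_le {α : ℝ} (hα : Real.sin α ≠ 0)
    {f : (Fin n → ℝ) → ℂ} (hf : Integrable f (torusMeasure n α)) {ε : ℝ} (hε : 0 < ε) :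
    ∀ᵐ x ∂torusMeasure n α, ∀ᶠ N in atTop, ‖fejerMean α N f x - f x‖ ≤ 3 * ε := by
  obtain ⟨C, hC⟩ := exists_mul_meas_maximalFejer_le n
  rw [ae_iff]
  set B := {x | ¬ ∀ᶠ N in atTop, ‖fejerMean α N f x - f x‖ ≤ 3 * ε} with hB
  -- `δ` bounds the `L¹` error of the approximation and is arbitrary, so `B` is a null set.
  have key : ∀ δ : ℝ≥0∞, δ ≠ 0 →
      ENNReal.ofReal ε * torusMeasure n α B ≤ (C + 1) * δ := by
    intro δ hδ
    have hg : Integrable (fun y => chirp α y * f y) (torusMeasure n α) :=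
      Integrable.bdd_mul (c := 1) hf (continuous_chirp α).aestronglyMeasurable
        (Eventually.of_forall fun y => (norm_chirp α y).le)
    obtain ⟨P, hP, hPδ⟩ := exists_mem_span_eLpNorm_sub_le hα hg hδ
    set φ : (Fin n → ℝ) → ℂ := fun y => chirp (-α) y * P (toUnitTorus (Real.sin α) y) with hφ
    have hφi : Integrable φ (torusMeasure n α) := integrable_chirp_mul P
    have hnorm : eLpNorm (f - φ) 1 (torusMeasure n α) ≤ δ := by
      refine le_trans (le_of_eq ?_) hPδ
      refine eLpNorm_congr_norm_ae (Eventually.of_forall fun y => ?_)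
      have h : chirp α y * f y - P (toUnitTorus (Real.sin α) y) = chirp α y * (f - φ) y := by
        rw [Pi.sub_apply, mul_sub, hφ, ← mul_assoc, chirp_mul_chirp_neg, one_mul]
      rw [h, norm_mul, norm_chirp, one_mul]
    have hsub : B ⊆ {x | ENNReal.ofReal ε < maximalFejer α (f - φ) x} ∪
        {x | ENNReal.ofReal ε ≤ ‖(f - φ) x‖ₑ} := by
      intro x hx
      by_contra hcon
      simp only [Set.mem_union, Set.mem_ofPred_eq, not_or, not_lt, not_le] at hcon
      refine hx ?_
      have h1 := Metric.tendsto_nhds.1 (tendsto_fejerMean_of_mem_span hα hP x) ε hε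
      filter_upwards [h1] with N hN
      rw [dist_eq_norm] at hN
      have h2 : ‖fejerMean α N (f - φ) x‖ ≤ ε := by
        have := (le_iSup (fun N => ‖fejerMean α N (f - φ) x‖ₑ) N).trans hcon.1
        rw [← ofReal_norm] at this
        exact (ENNReal.ofReal_le_ofReal_iff hε.le).1 this
      have h3 : ‖(f - φ) x‖ ≤ ε := by
        have := hcon.2.le
        rw [← ofReal_norm] at this
        exact (ENNReal.ofReal_le_ofReal_iff hε.le).1 this
      rw [fejerMean_sub hf hφi] at h2
      have h4 : fejerMean α N f x - f x = (fejerMean α N f x - fejerMean α N φ x)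
          + (fejerMean α N φ x - φ x) - (f - φ) x := by
        rw [Pi.sub_apply]; ring
      rw [h4]
      refine (norm_sub_le _ _).trans ((add_le_add_left (norm_add_le _ _) _).trans ?_)
      have h5 : ‖fejerMean α N φ x - φ x‖ < ε := hN
      linarith
    calc ENNReal.ofReal ε * torusMeasure n α B
        ≤ ENNReal.ofReal ε * (torusMeasure n α {x | ENNReal.ofReal ε < maximalFejer α (f - φ) x} +
          torusMeasure n α {x | ENNReal.ofReal ε ≤ ‖(f - φ) x‖ₑ}) := by
          gcongr
          exact (measure_mono hsub).trans (measure_union_le _ _)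
      _ ≤ C * eLpNorm (f - φ) 1 (torusMeasure n α) + eLpNorm (f - φ) 1 (torusMeasure n α) := by
          rw [mul_add]
          refine add_le_add (hC α hα _ (hf.sub hφi).aestronglyMeasurable _) ?_
          rw [eLpNorm_one_eq_lintegral_enorm]
          exact mul_meas_ge_le_lintegral₀ (hf.sub hφi).aestronglyMeasurable.enorm _
      _ ≤ C * δ + δ := by gcongr
      _ = (C + 1) * δ := by ring
  have hε0 : ENNReal.ofReal ε ≠ 0 := by simpa using hε
  by_contra hne
  obtain ⟨m, hm⟩ := ENNReal.exists_nat_mul_gt (mul_ne_zero hε0 hne)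
    (b := (C : ℝ≥0∞) + 1) (by finiteness)
  have hm0 : (m : ℝ≥0∞) ≠ 0 := by
    rintro h
    rw [h, zero_mul] at hm
    exact not_lt_zero hm
  refine hm.not_ge ?_
  calc (m : ℝ≥0∞) * (ENNReal.ofReal ε * torusMeasure n α B)
      ≤ m * ((C + 1) * (m : ℝ≥0∞)⁻¹) := by
        gcongr _ * ?_
        exact key _ (ENNReal.inv_ne_zero.2 (ENNReal.natCast_ne_top m))
    _ = (C + 1) * (m * (m : ℝ≥0∞)⁻¹) := by ring
    _ = C + 1 := by rw [ENNReal.mul_inv_cancel hm0 (ENNReal.natCast_ne_top m), mul_one]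

theorem ae_tendsto_fejerMean {α : ℝ} (hα : Real.sin α ≠ 0) {f : (Fin n → ℝ) → ℂ}
    (hf : Integrable f (torusMeasure n α)) :
    ∀ᵐ x ∂torusMeasure n α, Tendsto (fun N => fejerMean α N f x) atTop (𝓝 (f x)) := by
  have h := ae_all_iff.2 fun m : ℕ => ae_eventually_norm_fejerMean_sub_le hα hf
    (ε := 1 / (m + 1)) (by positivity)
  filter_upwards [h] with x hx
  refine Metric.tendsto_nhds.2 fun ε hε => ?_
  obtain ⟨m, hm⟩ := exists_nat_one_div_lt (show (0 : ℝ) < ε / 3 by positivity)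
  filter_upwards [hx m] with N hN
  rw [dist_eq_norm]
  linarith

end

theorem theorem5p2 (n : ℕ) (α : ℝ) (hα : ∀ k : ℤ, α ≠ k * Real.pi) :
    (∃ C : ℝ≥0, ∀ f : (Fin n → ℝ) → ℂ, MemFracLp α 1 f →
      MemTorusWeakL1 α (maximalFejer α f) ∧
      weakL1Norm (maximalFejer α f) (torusMeasure n α) ≤
        C * eLpNorm f 1 (torusMeasure n α)) ∧
    (∀ p : ℝ≥0∞, 1 < p → ∃ C : ℝ≥0, ∀ f : (Fin n → ℝ) → ℂ, MemFracLp α p f →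
      MemTorusLp α p (maximalFejer α f) ∧
      eLpNorm (maximalFejer α f) p (torusMeasure n α) ≤
        C * eLpNorm f p (torusMeasure n α)) ∧
    (∀ f : (Fin n → ℝ) → ℂ, MemFracLp α 1 f →
      ∀ᵐ x ∂(torusMeasure n α),
        Tendsto (fun N : ℕ => fejerMean α N f x) atTop (𝓝 (f x))) := by
  have hs := sin_ne_zero_of_ne_int_mul_pi hα
  refine ⟨?_, fun p hp => ?_, fun f hf => ae_tendsto_fejerMean hs (hf.integrable le_rfl)⟩
  · obtain ⟨C, hC⟩ := exists_mul_meas_maximalFejer_le n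
    refine ⟨C, fun f hf => ?_⟩
    have hw : weakL1Norm (maximalFejer α f) (torusMeasure n α)
        ≤ C * eLpNorm f 1 (torusMeasure n α) :=
      iSup_le fun t => by
        simp only [enorm_eq_self]
        exact hC α hs f hf.aestronglyMeasurable t
    exact ⟨⟨isTorusFun_maximalFejer hs f,
      (measurable_maximalFejer (hf.integrable le_rfl)).aestronglyMeasurable,
      hw.trans_lt (ENNReal.mul_lt_top ENNReal.coe_lt_top hf.2)⟩, hw⟩
  · obtain ⟨C, hC⟩ : ∃ C : ℝ≥0, ∀ f : (Fin n → ℝ) → ℂ, MemFracLp α p f →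
        eLpNorm (maximalFejer α f) p (torusMeasure n α)
          ≤ C * eLpNorm f p (torusMeasure n α) := by
      by_cases hp' : p = ∞
      · subst hp'
        obtain ⟨C, hC⟩ := exists_eLpNorm_top_maximalFejer_le n
        exact ⟨C, fun f hf => hC α hs f hf.aestronglyMeasurable⟩
      · obtain ⟨C, hC⟩ := exists_eLpNorm_maximalFejer_le n hp hp'
        exact ⟨C, fun f hf => hC α hs f (hf.integrable hp.le)⟩
    exact ⟨C, fun f hf => ⟨⟨isTorusFun_maximalFejer hs f,
      (measurable_maximalFejer (hf.integrable hp.le)).aestronglyMeasurable,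
      (hC f hf).trans_lt (ENNReal.mul_lt_top ENNReal.coe_lt_top hf.2)⟩, hC f hf⟩⟩
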